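/- Let $T>0$, $\alpha>0$, $\Lambda>0$ and $\Phi_0\in\mathbb R$. Let $(\Omega,\mathcal F,\mathbb P)$ be a probability space with a filtration $(\mathcal G_t)_{t\in[0,T]}$ satisfying the usual conditions (right-continuous and completed), and let $S=(S_t)_{t\in[0,T]}$ be a real-valued càdlàg process adapted to $(\mathcal G_t)$ such that, for some $a>0$, $$\sup_{t\in[0,T]}\mathbb E\left[\exp(aS_t^2)\right]<\infty .$$ Let $\mathcal A$ be the set of all $(\mathcal G_t)$-optional processes $\phi=(\phi_t)_{t\in[0,T]}$ with $\int_0^T\phi_t^2\,dt<\infty$ almost surely, and for $\phi\in\mathcal A$ put $$V^{\Phi_0,\phi}_T=\Phi_0(S_T-S_0)+\int_0^T(S_T-S_t)\phi_t\,dt-\frac{\Lambda}{2}\int_0^T\phi_t^2\,dt .$$ Let $\mathcal Q$ be the set of all probability measures $\mathbb Q\sim\mathbb P$ on $\mathcal F$ with $\mathbb E_{\mathbb Q}\left[\log\frac{d\mathbb Q}{d\mathbb P}\right]<\infty$. For $\mathbb Q\in\mathcal Q$, the random variable $S_T$ is $\mathbb Q$-integrable, and $(\mathbb E_{\mathbb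 Q}[S_T|\mathcal G_t])_{t\in[0,T]}$ denotes a càdlàg version of this $\mathbb Q$-martingale, which exists. Then the random variable in the expectation on the right-hand side below is $\mathbb Q$-integrable for every $\mathbb Q\in\mathcal Q$, and $$\max_{\phi\in\mathcal A}\left\{-\frac1\alpha\log\mathbb E\left[\exp\left(-\alpha V^{\Phi_0,\phi}_T\right)\right]\right\} =\min_{\mathbb Q\in\mathcal Q}\mathbb E_{\mathbb Q}\left[\Phi_0(S_T-S_0)+\frac1\alpha\log\frac{d\mathbb Q}{d\mathbb P}+\frac1{2\Lambda}\int_0^T\left|\mathbb E_{\mathbb Q}[S_T|\mathcal G_t]-S_t\right|^2dt\right],$$ where the left-hand functional is $-\infty$ if the expectation is $+\infty$, and where both the maximum and the minimum are attained. Furthermore, the minimizer $\hat{\mathbb Q}$ on the right-hand side is unique, and the process $$\hat\phi_t=\frac{\mathbb E_{\hat{\mathbb Q}}[S_T|\mathcal G_t]-S_t}{\Lambda},\qquad t\in[0,T],$$ belongs to $\mathcal A$ and is, up to $dt\otimes\mathbb P$-null sets, the unique maximizer on the left-hand side. -/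

import Mathlib

open MeasureTheory Set Filter Topology
open scoped ENNReal

noncomputable section

namespace PriceImpact

/-- The time interval `[0, T]`, used as the index set of all processes. -/
abbrev Time (T : ℝ) : Type := ↥(Set.Icc (0 : ℝ) T)

/-- The initial time `0` in `[0, T]`. -/
def initialTime {T : ℝ} (hT : 0 < T) : Time T := ⟨0, le_refl 0, hT.le⟩

/-- The terminal time `T` in `[0, T]`. -/
def terminalTime {T : ℝ} (hT : 0 < T) : Time T := ⟨T, hT.le, le_refl T⟩

/-- Lebesgue measure on `[0, T]`. -/
def timeMeasure (T : ℝ) : Measure (Time T) := Measure.comap Subtype.val (volume : Measure ℝ)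

/-- A càdlàg path on `[0, T]`: right-continuous with (finite) left limits. At `t = 0` the left limit
and at `t = T` the right-continuity are void, since the one-sided neighbourhoods are trivial. -/
def IsCadlagPath {T : ℝ} (f : Time T → ℝ) : Prop :=
  ∀ t : Time T, ContinuousWithinAt f (Set.Ici t) t ∧ ∃ l : ℝ, Tendsto f (𝓝[<] t) (𝓝 l)

section Probability

variable {Ω : Type*} [mΩ : MeasurableSpace Ω] {T : ℝ}

/-- The usual conditions: the filtration is right-continuous, and every `𝒢 t` contains all
`P`-null sets (so that `P` is complete as well). -/
structure UsualConditions (P : Measure Ω) (𝒢 : Filtration (Time T) mΩ) : Prop where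
  rightContinuous : 𝒢.IsRightContinuous
  complete : ∀ (t : Time T) (N : Set Ω), P N = 0 → MeasurableSet[𝒢 t] N

/-- An adapted process all of whose paths are càdlàg. -/
structure IsCadlagAdapted (𝒢 : Filtration (Time T) mΩ) (X : Time T → Ω → ℝ) : Prop where
  adapted : Adapted 𝒢 X
  cadlag : ∀ ω, IsCadlagPath (fun t => X t ω)

/-- The optional σ-algebra on `[0, T] × Ω`: the one generated by the càdlàg adapted processes. -/
@[reducible]
def optionalSigma (𝒢 : Filtration (Time T) mΩ) : MeasurableSpace (Time T × Ω) :=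
  ⨆ (X : Time T → Ω → ℝ) (_ : IsCadlagAdapted 𝒢 X),
    MeasurableSpace.comap (Function.uncurry X) (borel ℝ)

/-- Optional processes. -/
def IsOptional (𝒢 : Filtration (Time T) mΩ) (φ : Time T → Ω → ℝ) : Prop :=
  Measurable[optionalSigma 𝒢, borel ℝ] (Function.uncurry φ)

/-- The admissible strategies (turnover rates): optional processes `φ` with
`∫₀ᵀ φ_t² dt < ∞` almost surely. -/
def admissible (P : Measure Ω) (𝒢 : Filtration (Time T) mΩ) : Set (Time T → Ω → ℝ) :=
  {φ | IsOptional 𝒢 φ ∧ ∀ᵐ ω ∂P, (∫⁻ t, ENNReal.ofReal (φ t ω ^ 2) ∂(timeMeasure T)) < ∞}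

/-- The terminal profits and losses
`V = Φ₀ (S_T - S_0) + ∫₀ᵀ (S_T - S_t) φ_t dt - (Λ/2) ∫₀ᵀ φ_t² dt`. -/
def pnl (hT : 0 < T) (S : Time T → Ω → ℝ) (Λ Φ₀ : ℝ) (φ : Time T → Ω → ℝ) (ω : Ω) : ℝ :=
  Φ₀ * (S (terminalTime hT) ω - S (initialTime hT) ω)
    + (∫ t, (S (terminalTime hT) ω - S t ω) * φ t ω ∂(timeMeasure T))
    - Λ / 2 * (∫ t, φ t ω ^ 2 ∂(timeMeasure T))

/-- The certainty equivalent `-(1/α) log E[exp (-α V)]` of a strategy. It takes values in the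
extended reals and is `-∞` if the expectation is `+∞`. -/
def certaintyEquivalent (P : Measure Ω) (hT : 0 < T) (S : Time T → Ω → ℝ) (α Λ Φ₀ : ℝ)
    (φ : Time T → Ω → ℝ) : EReal :=
  ((-(1 / α) : ℝ) : EReal) *
    ENNReal.log (∫⁻ ω, ENNReal.ofReal (Real.exp (-α * pnl hT S Λ Φ₀ φ ω)) ∂P)

/-- The probability measures `Q ∼ P` with finite relative entropy `E_Q[log dQ/dP] < ∞`. (As the
negative part of `log dQ/dP` is always `Q`-integrable, finiteness means integrability; `llr Q P`
is `log dQ/dP`.) -/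
def finiteEntropy (P : Measure Ω) : Set (Measure Ω) :=
  {Q | IsProbabilityMeasure Q ∧ Q ≪ P ∧ P ≪ Q ∧ Integrable (llr Q P) Q}

/-- `M` is a càdlàg adapted version of the `Q`-martingale `E_Q[X | 𝒢_t]`, `t ∈ [0, T]`. -/
structure IsMartingaleVersion (Q : Measure Ω) (𝒢 : Filtration (Time T) mΩ) (X : Ω → ℝ)
    (M : Time T → Ω → ℝ) : Prop where
  cadlagAdapted : IsCadlagAdapted 𝒢 M
  version : ∀ t, M t =ᵐ[Q] Q[X | 𝒢 t]

open Classical in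
/-- The process `E_Q[X | 𝒢_t]`, `t ∈ [0, T]`, in a càdlàg adapted version (any two such versions
are indistinguishable). -/
def condExpVersion (Q : Measure Ω) (𝒢 : Filtration (Time T) mΩ) (X : Ω → ℝ) : Time T → Ω → ℝ :=
  if h : ∃ M, IsMartingaleVersion Q 𝒢 X M then h.choose else fun _ _ => 0

theorem isMartingaleVersion_condExpVersion {Q : Measure Ω} {𝒢 : Filtration (Time T) mΩ}
    {X : Ω → ℝ} (h : ∃ M, IsMartingaleVersion Q 𝒢 X M) :
    IsMartingaleVersion Q 𝒢 X (condExpVersion Q 𝒢 X) := by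
  unfold condExpVersion
  rw [dif_pos h]
  exact h.choose_spec

/-- The random variable
`Φ₀ (S_T - S_0) + (1/α) log dQ/dP + (1/(2Λ)) ∫₀ᵀ |E_Q[S_T | 𝒢_t] - S_t|² dt`. -/
def dualIntegrand (P : Measure Ω) (𝒢 : Filtration (Time T) mΩ) (hT : 0 < T)
    (S : Time T → Ω → ℝ) (α Λ Φ₀ : ℝ) (Q : Measure Ω) (ω : Ω) : ℝ :=
  Φ₀ * (S (terminalTime hT) ω - S (initialTime hT) ω)
    + 1 / α * llr Q P ω
    + 1 / (2 * Λ) *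
      (∫ t, |condExpVersion Q 𝒢 (S (terminalTime hT)) t ω - S t ω| ^ 2 ∂(timeMeasure T))

/-- The dual target functional: the `Q`-expectation of `dualIntegrand`. -/
def dualFunctional (P : Measure Ω) (𝒢 : Filtration (Time T) mΩ) (hT : 0 < T)
    (S : Time T → Ω → ℝ) (α Λ Φ₀ : ℝ) (Q : Measure Ω) : ℝ :=
  ∫ ω, dualIntegrand P 𝒢 hT S α Λ Φ₀ Q ω ∂Q

/-- The turnover rate `φ_t = (E_Q[S_T | 𝒢_t] - S_t) / Λ` induced by `Q`. -/
def inducedStrategy (𝒢 : Filtration (Time T) mΩ) (hT : 0 < T) (S : Time T → Ω → ℝ) (Λ : ℝ)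
    (Q : Measure Ω) : Time T → Ω → ℝ :=
  fun t ω => (condExpVersion Q 𝒢 (S (terminalTime hT)) t ω - S t ω) / Λ

end Probability

end PriceImpact

end

/-! Along each path the gain of a strategy is a strongly concave quadratic V(φ) = c + ∫ Dφ - (Λ/2) ∫
φ², with c = Φ₀ (S_T - S_0) and D_t = S_T - S_t. The primal problem is to minimize J(φ) = E[exp
(-αV(φ))].

Existence. If φ and ψ are almost minimal, so is their midpoint, and strong concavity makes the
midpoint better by at least E[exp (-αB) (1 - exp (-(αΛ/8) ∫ (φ - ψ)²))], where B = c + (1/Λ) ∫ D²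
bounds every gain and does not depend on the strategy. Hence a fast minimizing sequence has paths
that are almost surely Cauchy in L² by Borel–Cantelli, and Fatou's lemma shows that the limit is
optimal (`exists_disutility_minimal`). The same estimate with zero error gives uniqueness.

Weak duality. For Q of finite entropy put g = (E_Q[S_T | 𝒢_t] - S_t)/Λ. Against optional integrands
D acts under Q as Λg, so completing the square gives E_Q[V(φ)] = E_Q[c] + (Λ/2)‖g‖² - (Λ/2)‖φ - g‖²
in L²(dt ⊗ Q) (`integral_gain`). Gibbs' inequality bounds -(1/α) log J(φ) by E_Q[V(φ)] plus the
entropy term, hence by the dual value of Q (`log_disutility_le_dualValue`).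

Strong duality. Let φ be optimal and let Q' have density proportional to exp (-αV(φ)). The
first-order condition says that Q' has finite entropy and that φ maximizes the expected gain under
Q' among strategies of finite disutility (`tilted_mem_finiteEntropy_of_minimal`). Bounded
truncations of g are such strategies, so φ = g (`ae_eq_of_integral_gain_le`), and both inequalities
of weak duality become equalities. Any other dual minimizer would be a case of equality in Gibbs'
inequality against the same φ, hence equal to Q'.

The exponential moment of S² makes bounded strategies have finite disutility and gives square
integrability under every Q of finite entropy. Càdlàg versions of the martingales come from Doob's
upcrossing and maximal inequalities on dyadic grids, together with the usual conditions. -/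

namespace PriceImpact

/-! ### The quadratic gain along one path -/

section Pathwise

variable {𝕋 : Type*} [MeasurableSpace 𝕋] {τ : Measure 𝕋}

/-- The concave quadratic functional `c + ∫ d f - (Λ/2) ∫ f²`. -/
noncomputable def quad (τ : Measure 𝕋) (Λ c : ℝ) (d f : 𝕋 → ℝ) : ℝ :=
  c + (∫ t, d t * f t ∂τ) - Λ / 2 * ∫ t, f t ^ 2 ∂τ

theorem integrable_mul_of_memLp_two {f g : 𝕋 → ℝ} (hf : MemLp f 2 τ) (hg : MemLp g 2 τ) :
    Integrable (fun t => f t * g t) τ :=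
  hf.integrable_mul hg

theorem integral_mul_eq_inner {f g : 𝕋 → ℝ} (hf : MemLp f 2 τ) (hg : MemLp g 2 τ) :
    ∫ t, f t * g t ∂τ = inner ℝ (hf.toLp f) (hg.toLp g) := by
  rw [L2.inner_def]
  refine integral_congr_ae ?_
  filter_upwards [hf.coeFn_toLp, hg.coeFn_toLp] with t h1 h2
  simp [h1, h2, mul_comm]

theorem integral_sq_eq_norm_sq {f : 𝕋 → ℝ} (hf : MemLp f 2 τ) :
    ∫ t, f t ^ 2 ∂τ = ‖hf.toLp f‖ ^ 2 := by
  rw [← real_inner_self_eq_norm_sq, ← integral_mul_eq_inner hf hf]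
  simp [sq]

theorem quad_convexComb {Λ c : ℝ} {d f g : 𝕋 → ℝ} (hd : MemLp d 2 τ) (hf : MemLp f 2 τ)
    (hg : MemLp g 2 τ) (s : ℝ) :
    quad τ Λ c d (fun t => (1 - s) * f t + s * g t) =
      (1 - s) * quad τ Λ c d f + s * quad τ Λ c d g
        + s * (1 - s) * (Λ / 2) * ∫ t, (f t - g t) ^ 2 ∂τ := by
  have hdf := integrable_mul_of_memLp_two hd hf
  have hdg := integrable_mul_of_memLp_two hd hg
  have hfg := integrable_mul_of_memLp_two hf hg
  have hff := hf.integrable_sq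
  have hgg := hg.integrable_sq
  have e1 : ∫ t, d t * ((1 - s) * f t + s * g t) ∂τ
      = (1 - s) * (∫ t, d t * f t ∂τ) + s * ∫ t, d t * g t ∂τ := by
    rw [← integral_const_mul, ← integral_const_mul,
      ← integral_add (hdf.const_mul _) (hdg.const_mul _)]
    congr 1; ext t; ring
  have hI : Integrable (fun t => (1 - s) ^ 2 * f t ^ 2 + 2 * s * (1 - s) * (f t * g t)) τ :=
    (hff.const_mul ((1 - s) ^ 2)).add (hfg.const_mul (2 * s * (1 - s)))
  have hI' : Integrable (fun t => f t ^ 2 - 2 * (f t * g t)) τ := hff.sub (hfg.const_mul 2)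
  have e2 : ∫ t, ((1 - s) * f t + s * g t) ^ 2 ∂τ
      = (1 - s) ^ 2 * (∫ t, f t ^ 2 ∂τ) + 2 * s * (1 - s) * (∫ t, f t * g t ∂τ)
        + s ^ 2 * ∫ t, g t ^ 2 ∂τ := by
    rw [← integral_const_mul, ← integral_const_mul, ← integral_const_mul,
      ← integral_add (hff.const_mul _) (hfg.const_mul _),
      ← integral_add hI (hgg.const_mul _)]
    congr 1; ext t; ring
  have e3 : ∫ t, (f t - g t) ^ 2 ∂τ
      = (∫ t, f t ^ 2 ∂τ) - 2 * (∫ t, f t * g t ∂τ) + ∫ t, g t ^ 2 ∂τ := by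
    rw [← integral_const_mul, ← integral_sub hff (hfg.const_mul _),
      ← integral_add hI' hgg]
    congr 1; ext t; ring
  simp only [quad, e1, e2, e3]
  ring

/-- Young's inequality d f ≤ d²/Λ + (Λ/4) f² spends only half of the quadratic cost. The other half
stays on the left and later controls the L² norm of the strategy. -/
theorem quad_add_le {Λ c : ℝ} (hΛ : 0 < Λ) {d f : 𝕋 → ℝ} (hd : MemLp d 2 τ) (hf : MemLp f 2 τ) :
    quad τ Λ c d f + Λ / 4 * ∫ t, f t ^ 2 ∂τ ≤ c + 1 / Λ * ∫ t, d t ^ 2 ∂τ := by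
  have hdf := integrable_mul_of_memLp_two hd hf
  have h : ∫ t, d t * f t ∂τ ≤ 1 / Λ * (∫ t, d t ^ 2 ∂τ) + Λ / 4 * ∫ t, f t ^ 2 ∂τ := by
    rw [← integral_const_mul, ← integral_const_mul,
      ← integral_add (hd.integrable_sq.const_mul _) (hf.integrable_sq.const_mul _)]
    refine integral_mono hdf
      ((hd.integrable_sq.const_mul _).add (hf.integrable_sq.const_mul _)) fun t => ?_
    have : 1 / Λ * d t ^ 2 + Λ / 4 * f t ^ 2 - d t * f t = 1 / Λ * (d t - Λ / 2 * f t) ^ 2 := by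
      field_simp; ring
    have h2 : 0 ≤ 1 / Λ * (d t - Λ / 2 * f t) ^ 2 := by positivity
    simp only
    linarith
  simp only [quad]
  linarith

theorem quad_le {Λ c : ℝ} (hΛ : 0 < Λ) {d f : 𝕋 → ℝ} (hd : MemLp d 2 τ) (hf : MemLp f 2 τ) :
    quad τ Λ c d f ≤ c + 1 / Λ * ∫ t, d t ^ 2 ∂τ := by
  have h1 := quad_add_le (c := c) hΛ hd hf
  have h2 : 0 ≤ Λ / 4 * ∫ t, f t ^ 2 ∂τ :=
    mul_nonneg (by positivity) (integral_nonneg fun t => sq_nonneg _)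
  linarith

theorem quad_eq_toLp {Λ c : ℝ} {d f : 𝕋 → ℝ} (hd : MemLp d 2 τ) (hf : MemLp f 2 τ) :
    quad τ Λ c d f = c + inner ℝ (hd.toLp d) (hf.toLp f) - Λ / 2 * ‖hf.toLp f‖ ^ 2 := by
  rw [quad, integral_mul_eq_inner hd hf, integral_sq_eq_norm_sq hf]

theorem tendsto_quad {Λ c : ℝ} {d : 𝕋 → ℝ} (hd : MemLp d 2 τ) {f : ℕ → 𝕋 → ℝ}
    (hf : ∀ n, MemLp (f n) 2 τ) {g : 𝕋 → ℝ} (hg : MemLp g 2 τ)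
    (h : Tendsto (fun n => (hf n).toLp (f n)) atTop (𝓝 (hg.toLp g))) :
    Tendsto (fun n => quad τ Λ c d (f n)) atTop (𝓝 (quad τ Λ c d g)) := by
  simp only [quad_eq_toLp hd (hf _), quad_eq_toLp hd hg]
  exact ((tendsto_const_nhds.inner h).const_add _).sub ((h.norm.pow 2).const_mul _)

/-- The L² limit is represented by the pointwise `limsup`, a formula that does not depend on the
path, so that the limit of optional processes is again optional. -/
theorem exists_toLp_tendsto_limsup_of_geometric {f : ℕ → 𝕋 → ℝ}
    (hf : ∀ n, MemLp (f n) 2 τ)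
    (h : ∀ᶠ n in atTop, ∫ t, (f n t - f (n + 1) t) ^ 2 ∂τ ≤ (1 / 4 : ℝ) ^ n) :
    ∃ hg : MemLp (fun t => limsup (fun n => f n t) atTop) 2 τ,
      Tendsto (fun n => (hf n).toLp (f n)) atTop (𝓝 (hg.toLp _)) := by
  obtain ⟨N, hN⟩ := eventually_atTop.1 h
  have hdist : ∀ n, N ≤ n → dist ((hf n).toLp (f n)) ((hf (n + 1)).toLp (f (n + 1)))
      ≤ (1 / 2 : ℝ) ^ n := by
    intro n hn
    have h1 : dist ((hf n).toLp (f n)) ((hf (n + 1)).toLp (f (n + 1))) ^ 2 ≤ ((1 / 2 : ℝ) ^ n) ^ 2 := by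
      rw [dist_eq_norm, ← MemLp.toLp_sub, ← integral_sq_eq_norm_sq]
      refine (hN n hn).trans (le_of_eq ?_)
      rw [← pow_mul, mul_comm, pow_mul]; norm_num
    exact le_of_sq_le_sq h1 (by positivity)
  set u : ℕ → Lp ℝ 2 τ := fun n => (hf (n + N)).toLp (f (n + N)) with hu
  have hgeo : ∀ n, dist (u n) (u (n + 1)) ≤ (2 : ℝ) / 2 / 2 ^ n := by
    intro n
    have h1 := hdist (n + N) (by omega)
    have h2 : (1 / 2 : ℝ) ^ (n + N) ≤ 2 / 2 / 2 ^ n := by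
      rw [pow_add, one_div_pow (2 : ℝ) n]
      have : (1 / 2 : ℝ) ^ N ≤ 1 := pow_le_one₀ (by norm_num) (by norm_num)
      have h3 : (0 : ℝ) ≤ 1 / 2 ^ n := by positivity
      calc 1 / 2 ^ n * (1 / 2 : ℝ) ^ N ≤ 1 / 2 ^ n * 1 := by gcongr
        _ = _ := by ring
    have h3 : u (n + 1) = (hf (n + N + 1)).toLp (f (n + N + 1)) := by
      simp only [hu]; congr 1; congr 1; omega
    rw [h3]
    exact h1.trans h2
  obtain ⟨G, hG⟩ := cauchySeq_tendsto_of_complete (cauchySeq_of_le_geometric_two hgeo)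
  have hdistG : ∀ n, dist (u n) G ≤ 2 / 2 ^ n := fun n =>
    dist_le_of_le_geometric_two_of_tendsto hgeo hG n
  -- Terms of index at least K lie within 2/2^K of the limit, so their mutual distance is at most
  -- 4/2^K; the constant 5 makes the inequality strict.
  have hsum : ∑' n : ℕ, ENNReal.ofReal (5 / 2 ^ n) ≠ ∞ := by
    rw [← ENNReal.ofReal_tsum_of_nonneg (fun n => by positivity)]
    · exact ENNReal.ofReal_ne_top
    · simpa [div_eq_mul_inv] using (summable_geometric_two.mul_left 5)
  have hae := Lp.ae_tendsto_of_cauchy_eLpNorm (μ := τ) (p := 2) (f := fun n => f (n + N))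
    (fun n => (hf _).1) (by norm_num) hsum (by
      intro K n m hn hm
      rw [← Lp.edist_toLp_toLp (f (n + N)) (f (m + N)) (hf _) (hf _), edist_dist]
      refine (ENNReal.ofReal_lt_ofReal_iff (by positivity)).2 ?_
      have hmono : ∀ k, K ≤ k → dist (u k) G ≤ 2 / 2 ^ K := fun k hk =>
        (hdistG k).trans (by gcongr; norm_num)
      calc dist (u n) (u m) ≤ dist (u n) G + dist (u m) G := dist_triangle_right _ _ _
        _ ≤ 2 / 2 ^ K + 2 / 2 ^ K := add_le_add (hmono n hn) (hmono m hm)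
        _ = 4 / 2 ^ K := by ring
        _ < 5 / 2 ^ K := by gcongr; norm_num)
  have hG' : Tendsto (fun n => (hf n).toLp (f n)) atTop (𝓝 G) := (tendsto_add_atTop_iff_nat N).1 hG
  obtain ⟨ns, hns, hae2⟩ := (tendstoInMeasure_of_tendsto_eLpNorm (μ := τ) (p := 2) (by norm_num)
    (fun n => (hf n).1) (Lp.aestronglyMeasurable G)
    (by
      have := (Lp.tendsto_Lp_iff_tendsto_eLpNorm'' f hf (G : 𝕋 → ℝ) (Lp.memLp G)).1
        (by rwa [Lp.toLp_coeFn])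
      exact this)).exists_seq_tendsto_ae
  -- The whole sequence converges almost everywhere, and a subsequence does so to G; hence the
  -- pointwise limit is G.
  have hlim : (G : 𝕋 → ℝ) =ᵐ[τ] fun t => limsup (fun n => f n t) atTop := by
    filter_upwards [hae, hae2] with t h1 h2
    obtain ⟨l, hl⟩ := h1
    have hl' : Tendsto (fun n => f n t) atTop (𝓝 l) := (tendsto_add_atTop_iff_nat N).1 hl
    rw [hl'.limsup_eq]
    exact tendsto_nhds_unique h2 (hl'.comp hns.tendsto_atTop)
  have hg : MemLp (fun t => limsup (fun n => f n t) atTop) 2 τ :=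
    (memLp_congr_ae hlim).1 (Lp.memLp G)
  refine ⟨hg, ?_⟩
  have : hg.toLp _ = G := by
    rw [← Lp.toLp_coeFn G (Lp.memLp G)]
    exact (MemLp.toLp_eq_toLp_iff _ _).2 hlim.symm
  rwa [this]

end Pathwise

/-! ### Dyadic grids in [0, T] -/

section Grid

variable {T : ℝ}

/-- The `k`-th point of the dyadic grid of mesh `T / 2 ^ n` in `[0, T]`. -/
noncomputable def grid (hT : 0 < T) (n k : ℕ) : Time T :=
  ⟨min (k * T / 2 ^ n) T, le_min (by positivity) hT.le, min_le_right _ _⟩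

/-- The index of the first grid point after `t`. -/
noncomputable def nextIndex (n : ℕ) (t : Time T) : ℕ := ⌊(t : ℝ) * 2 ^ n / T⌋₊ + 1

/-- The first grid point after `t` (or `T`, if `t = T`). -/
noncomputable def gridAfter (hT : 0 < T) (n : ℕ) (t : Time T) : Time T := grid hT n (nextIndex n t)

theorem grid_mono (hT : 0 < T) (n : ℕ) : Monotone (grid hT n) := by
  intro i j h
  refine Subtype.mk_le_mk.2 (min_le_min_right _ ?_)
  gcongr

theorem grid_refine (hT : 0 < T) (n m k : ℕ) : grid hT (n + m) (k * 2 ^ m) = grid hT n k := by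
  refine Subtype.ext ?_
  simp only [grid]
  congr 1
  push_cast
  rw [pow_add]
  field_simp

theorem grid_zero (hT : 0 < T) (n : ℕ) : grid hT n 0 = initialTime hT := by
  refine Subtype.ext ?_
  simp [grid, initialTime, hT.le]

theorem exists_grid_eq_of_le (hT : 0 < T) {n m : ℕ} (h : n ≤ m) (k : ℕ) :
    ∃ j, grid hT m j = grid hT n k := by
  obtain ⟨i, rfl⟩ := Nat.exists_eq_add_of_le h
  exact ⟨_, grid_refine hT n i k⟩

theorem lt_nextIndex_mul (hT : 0 < T) (n : ℕ) (t : Time T) :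
    (t : ℝ) < nextIndex n t * T / 2 ^ n := by
  have h := Nat.lt_floor_add_one ((t : ℝ) * 2 ^ n / T)
  rw [div_lt_iff₀ hT] at h
  rw [lt_div_iff₀ (by positivity), nextIndex]
  push_cast
  exact h

theorem nextIndex_mul_le (hT : 0 < T) (n : ℕ) (t : Time T) :
    nextIndex n t * T / 2 ^ n ≤ (t : ℝ) + T / 2 ^ n := by
  have h := Nat.floor_le (a := (t : ℝ) * 2 ^ n / T) (div_nonneg (mul_nonneg t.2.1 (by positivity)) hT.le)
  rw [le_div_iff₀ hT] at h
  rw [div_le_iff₀ (by positivity), nextIndex, add_mul, div_mul_cancel₀ _ (by positivity)]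
  push_cast
  linarith

theorem le_gridAfter (hT : 0 < T) (n : ℕ) (t : Time T) : t ≤ gridAfter hT n t :=
  Subtype.coe_le_coe.1 (le_min (lt_nextIndex_mul hT n t).le t.2.2)

theorem lt_gridAfter (hT : 0 < T) (n : ℕ) {t : Time T} (ht : (t : ℝ) < T) :
    t < gridAfter hT n t :=
  Subtype.coe_lt_coe.1 (lt_min (lt_nextIndex_mul hT n t) ht)

theorem gridAfter_eq_self (hT : 0 < T) (n : ℕ) {t : Time T} (ht : ¬ (t : ℝ) < T) :
    gridAfter hT n t = t :=
  le_antisymm (Subtype.coe_le_coe.1 ((gridAfter hT n t).2.2.trans (not_lt.1 ht)))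
    (le_gridAfter hT n t)

theorem tendsto_gridAfter (hT : 0 < T) (t : Time T) :
    Tendsto (fun n => gridAfter hT n t) atTop (𝓝 t) := by
  rw [tendsto_subtype_rng]
  have h : Tendsto (fun n : ℕ => (t : ℝ) + T / 2 ^ n) atTop (𝓝 (t : ℝ)) := by
    have : Tendsto (fun n : ℕ => T * (1 / 2 : ℝ) ^ n) atTop (𝓝 0) := by
      simpa using (tendsto_pow_atTop_nhds_zero_of_lt_one (r := (1 / 2 : ℝ)) (by norm_num)
        (by norm_num)).const_mul T
    simpa [div_eq_mul_inv] using this.const_add (t : ℝ)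
  exact tendsto_of_tendsto_of_tendsto_of_le_of_le tendsto_const_nhds h
    (fun n => le_gridAfter hT n t)
    fun n => (min_le_left _ _).trans (nextIndex_mul_le hT n t)

theorem measurable_nextIndex (n : ℕ) : Measurable (nextIndex n : Time T → ℕ) := by
  unfold nextIndex
  exact (Nat.measurable_floor.comp (by fun_prop)).add_const 1

end Grid

/-! ### Measurability of optional processes and boundedness of càdlàg paths -/

section Optional

variable {Ω : Type*} [mΩ : MeasurableSpace Ω] {T : ℝ} {𝒢 : Filtration (Time T) mΩ}

theorem IsCadlagAdapted.tendsto_gridAfter (hT : 0 < T) {X : Time T → Ω → ℝ}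
    (hX : IsCadlagAdapted 𝒢 X) (t : Time T) (ω : Ω) :
    Tendsto (fun n => X (gridAfter hT n t) ω) atTop (𝓝 (X t ω)) :=
  (hX.cadlag ω t).1.tendsto.comp (tendsto_nhdsWithin_iff.2
    ⟨PriceImpact.tendsto_gridAfter hT t, Eventually.of_forall fun n => le_gridAfter hT n t⟩)

/-- By right-continuity the process is the pointwise limit of its values at the next grid point, and
each approximation involves only countably many times. -/
theorem IsCadlagAdapted.measurable_uncurry (hT : 0 < T) {X : Time T → Ω → ℝ}
    (hX : IsCadlagAdapted 𝒢 X) : Measurable (Function.uncurry X) := by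
  refine measurable_of_tendsto_metrizable (f := fun n (p : Time T × Ω) => X (gridAfter hT n p.1) p.2)
    (fun n => ?_) (tendsto_pi_nhds.2 fun p => hX.tendsto_gridAfter hT p.1 p.2)
  have h : Measurable fun p : ℕ × Ω => X (grid hT n p.1) p.2 :=
    measurable_from_prod_countable_right fun k => (hX.adapted (grid hT n k)).mono (𝒢.le _) le_rfl
  exact h.comp (((measurable_nextIndex n).comp measurable_fst).prodMk measurable_snd)

theorem optionalSigma_le (hT : 0 < T) : optionalSigma 𝒢 ≤ Prod.instMeasurableSpace :=
  iSup₂_le fun _ hX => (hX.measurable_uncurry hT).comap_le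

theorem IsOptional.measurable (hT : 0 < T) {φ : Time T → Ω → ℝ} (hφ : IsOptional 𝒢 φ) :
    Measurable (Function.uncurry φ) :=
  Measurable.mono hφ (optionalSigma_le hT) le_rfl

theorem IsCadlagAdapted.isOptional {X : Time T → Ω → ℝ} (hX : IsCadlagAdapted 𝒢 X) :
    IsOptional 𝒢 X := by
  refine Measurable.mono (comap_measurable (Function.uncurry X)) ?_ le_rfl
  exact le_iSup₂_of_le X hX le_rfl

theorem measurable_section_optionalSigma (t : Time T) :
    Measurable[𝒢 t, optionalSigma 𝒢] fun ω : Ω => (t, ω) := by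
  refine measurable_iff_comap_le.2 ?_
  rw [optionalSigma, MeasurableSpace.comap_iSup]
  refine iSup_le fun X => ?_
  rw [MeasurableSpace.comap_iSup]
  refine iSup_le fun hX => ?_
  rw [MeasurableSpace.comap_comp]
  exact measurable_iff_comap_le.1 (hX.adapted t)

theorem IsOptional.adapted {φ : Time T → Ω → ℝ} (hφ : IsOptional 𝒢 φ) : Adapted 𝒢 φ :=
  fun t => Measurable.comp (g := Function.uncurry φ) hφ (measurable_section_optionalSigma t)

/-- The one-sided limits bound the path near each point, and compactness of [0, T] makes the bound
global. -/
theorem IsCadlagPath.exists_abs_le {f : Time T → ℝ} (hf : IsCadlagPath f) :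
    ∃ C, ∀ t, |f t| ≤ C := by
  have h := isCompact_univ (X := Time T) |>.induction_on (p := fun s => ∃ C, ∀ t ∈ s, |f t| ≤ C)
    ⟨0, by simp⟩ (fun s t hst ⟨C, hC⟩ => ⟨C, fun x hx => hC x (hst hx)⟩)
    (fun s t ⟨C, hC⟩ ⟨C', hC'⟩ => ⟨max C C', fun x hx => hx.elim
      (fun h => (hC x h).trans (le_max_left _ _)) fun h => (hC' x h).trans (le_max_right _ _)⟩)
    (by
      intro t _
      obtain ⟨h1, l, h2⟩ := hf t
      have e1 : ∀ᶠ s in 𝓝[≥] t, |f s| ≤ |f t| + 1 :=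
        (h1.abs.eventually_lt continuousWithinAt_const (lt_add_one _)).mono fun s hs => hs.le
      have e2 : ∀ᶠ s in 𝓝[<] t, |f s| ≤ |l| + 1 :=
        (h2.abs.eventually_lt tendsto_const_nhds (lt_add_one _)).mono fun s hs => hs.le
      refine ⟨{s | |f s| ≤ max (|f t| + 1) (|l| + 1)}, ?_, _, fun s hs => hs⟩
      rw [nhdsWithin_univ, ← nhdsLT_sup_nhdsGE]
      exact mem_sup.2 ⟨e2.mono fun s hs => hs.trans (le_max_right _ _),
        e1.mono fun s hs => hs.trans (le_max_left _ _)⟩)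
  obtain ⟨C, hC⟩ := h
  exact ⟨C, fun t => hC t (mem_univ t)⟩

end Optional

/-! ### Existence and uniqueness of the primal optimizer -/

section Primal

variable {Ω : Type*} [mΩ : MeasurableSpace Ω] {T : ℝ} {τ : Measure (Time T)} {P : Measure Ω}
  {𝒢 : Filtration (Time T) mΩ} {α Λ : ℝ} {c : Ω → ℝ} {D : Time T → Ω → ℝ}

/-- The optional processes with almost all paths in `L²(τ)`. -/
def strategies (τ : Measure (Time T)) (P : Measure Ω) (𝒢 : Filtration (Time T) mΩ) :
    Set (Time T → Ω → ℝ) :=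
  {φ | IsOptional 𝒢 φ ∧ ∀ᵐ ω ∂P, MemLp (fun t => φ t ω) 2 τ}

/-- The pathwise quadratic functional of a strategy. -/
noncomputable def gain (τ : Measure (Time T)) (Λ : ℝ) (c : Ω → ℝ) (D φ : Time T → Ω → ℝ)
    (ω : Ω) : ℝ :=
  quad τ Λ (c ω) (fun t => D t ω) (fun t => φ t ω)

/-- The expectation `E[exp (-α V)]` for the gain `V` of a strategy. -/
noncomputable def disutility (τ : Measure (Time T)) (P : Measure Ω) (α Λ : ℝ) (c : Ω → ℝ)
    (D φ : Time T → Ω → ℝ) : ℝ≥0∞ :=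
  ∫⁻ ω, ENNReal.ofReal (Real.exp (-α * gain τ Λ c D φ ω)) ∂P

theorem measurable_integral_left [SFinite τ] {f : Time T → Ω → ℝ}
    (hf : Measurable (Function.uncurry f)) :
    Measurable fun ω => ∫ t, f t ω ∂τ :=
  (StronglyMeasurable.integral_prod_left hf.stronglyMeasurable).measurable

theorem measurable_gain [SFinite τ] (hc : Measurable c) (hD : Measurable (Function.uncurry D))
    {φ : Time T → Ω → ℝ} (hφ : Measurable (Function.uncurry φ)) : Measurable (gain τ Λ c D φ) := by
  refine (hc.add (measurable_integral_left ?_)).sub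
    ((measurable_integral_left (f := fun t ω => φ t ω ^ 2) ?_).const_mul _)
  · exact hD.mul hφ
  · exact hφ.pow_const 2

theorem convexComb_mem_strategies {φ ψ : Time T → Ω → ℝ} (hφ : φ ∈ strategies τ P 𝒢)
    (hψ : ψ ∈ strategies τ P 𝒢) (s : ℝ) :
    (fun t ω => (1 - s) * φ t ω + s * ψ t ω) ∈ strategies τ P 𝒢 := by
  refine ⟨(Measurable.const_mul hφ.1 _).add (Measurable.const_mul hψ.1 _), ?_⟩
  filter_upwards [hφ.2, hψ.2] with ω h1 h2
  exact (h1.const_mul _).add (h2.const_mul _)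

/-- With u² and v² the two exponentials, the midpoint contributes uv·exp (-(αΛ/8)x), where x is the
squared distance. The claim is (u² + v²)/2 ≥ uv combined with uv ≥ exp (-αB), where B is the bound
of `quad_le`. -/
theorem exp_midpoint_quad_le (hα : 0 < α) (hΛ : 0 < Λ) {c : ℝ} {d f g : Time T → ℝ}
    (hd : MemLp d 2 τ)
    (hf : MemLp f 2 τ) (hg : MemLp g 2 τ) :
    Real.exp (-α * (c + 1 / Λ * ∫ t, d t ^ 2 ∂τ))
        * (1 - Real.exp (-(α * Λ / 8) * ∫ t, (f t - g t) ^ 2 ∂τ))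
      + Real.exp (-α * quad τ Λ c d fun t => (1 - 1 / 2) * f t + 1 / 2 * g t)
      ≤ 1 / 2 * Real.exp (-α * quad τ Λ c d f) + 1 / 2 * Real.exp (-α * quad τ Λ c d g) := by
  rw [quad_convexComb hd hf hg]
  have hqf := quad_le (c := c) hΛ hd hf
  have hqg := quad_le (c := c) hΛ hd hg
  set B := c + 1 / Λ * ∫ t, d t ^ 2 ∂τ
  set qf := quad τ Λ c d f
  set qg := quad τ Λ c d g
  have hx : 0 ≤ ∫ t, (f t - g t) ^ 2 ∂τ := integral_nonneg fun t => sq_nonneg _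
  set x := ∫ t, (f t - g t) ^ 2 ∂τ
  set u := Real.exp (-α * qf / 2) with hu
  set v := Real.exp (-α * qg / 2) with hv
  have hfu : Real.exp (-α * qf) = u * u := by rw [hu, ← Real.exp_add]; ring_nf
  have hgv : Real.exp (-α * qg) = v * v := by rw [hv, ← Real.exp_add]; ring_nf
  have hmid : Real.exp (-α * ((1 - 1 / 2) * qf + 1 / 2 * qg + 1 / 2 * (1 - 1 / 2) * (Λ / 2) * x))
      = u * v * Real.exp (-(α * Λ / 8) * x) := by
    rw [hu, hv, ← Real.exp_add, ← Real.exp_add]; ring_nf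
  have hB : Real.exp (-α * B) ≤ u * v := by
    rw [hu, hv, ← Real.exp_add]
    apply Real.exp_le_exp.2
    nlinarith
  have h1 : 0 ≤ 1 - Real.exp (-(α * Λ / 8) * x) := by
    rw [sub_nonneg, Real.exp_le_one_iff]
    have : 0 ≤ α * Λ / 8 * x := by positivity
    linarith
  rw [hmid, hfu, hgv]
  nlinarith [mul_le_mul_of_nonneg_right hB h1, sq_nonneg (u - v)]

theorem lintegral_dist_add_disutility_midpoint_le [SFinite τ] (hα : 0 < α) (hΛ : 0 < Λ)
    (hT : 0 < T) (hc : Measurable c) (hD : Measurable (Function.uncurry D))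
    (hD2 : ∀ ω, MemLp (fun t => D t ω) 2 τ) {φ ψ : Time T → Ω → ℝ} (hφ : φ ∈ strategies τ P 𝒢)
    (hψ : ψ ∈ strategies τ P 𝒢) :
    (∫⁻ ω, ENNReal.ofReal (Real.exp (-α * (c ω + 1 / Λ * ∫ t, D t ω ^ 2 ∂τ))
        * (1 - Real.exp (-(α * Λ / 8) * ∫ t, (φ t ω - ψ t ω) ^ 2 ∂τ))) ∂P)
      + disutility τ P α Λ c D (fun t ω => (1 - 1 / 2) * φ t ω + 1 / 2 * ψ t ω)
      ≤ ENNReal.ofReal (1 / 2) * disutility τ P α Λ c D φ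
        + ENNReal.ofReal (1 / 2) * disutility τ P α Λ c D ψ := by
  have hφm := hφ.1.measurable hT
  have hψm := hψ.1.measurable hT
  have hmm := (convexComb_mem_strategies hφ hψ (1 / 2)).1.measurable hT
  have m1 := (((measurable_gain (Λ := Λ) (τ := τ) hc hD hφm).const_mul (-α)).exp).ennreal_ofReal
  have m2 := (((measurable_gain (Λ := Λ) (τ := τ) hc hD hψm).const_mul (-α)).exp).ennreal_ofReal
  have m3 := (((measurable_gain (Λ := Λ) (τ := τ) hc hD hmm).const_mul (-α)).exp).ennreal_ofReal
  unfold disutility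
  rw [← lintegral_add_right _ m3, ← lintegral_const_mul _ m1, ← lintegral_const_mul _ m2,
    ← lintegral_add_right _ (m2.const_mul _)]
  refine lintegral_mono_ae ?_
  filter_upwards [hφ.2, hψ.2] with ω h1 h2
  have h := exp_midpoint_quad_le (c := c ω) hα hΛ (hD2 ω) h1 h2
  have hnn : 0 ≤ Real.exp (-α * (c ω + 1 / Λ * ∫ t, D t ω ^ 2 ∂τ))
      * (1 - Real.exp (-(α * Λ / 8) * ∫ t, (φ t ω - ψ t ω) ^ 2 ∂τ)) := by
    refine mul_nonneg (Real.exp_pos _).le ?_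
    rw [sub_nonneg, Real.exp_le_one_iff]
    have : 0 ≤ α * Λ / 8 * ∫ t, (φ t ω - ψ t ω) ^ 2 ∂τ :=
      mul_nonneg (by positivity) (integral_nonneg fun t => sq_nonneg _)
    linarith
  rw [← ENNReal.ofReal_add hnn (Real.exp_pos _).le, ← ENNReal.ofReal_mul (by norm_num),
    ← ENNReal.ofReal_mul (by norm_num), ← ENNReal.ofReal_add (by positivity) (by positivity)]
  exact ENNReal.ofReal_le_ofReal h

/-- The midpoint is itself a strategy, so its disutility is at least I; whatever it gains over the
average of the two is at most δ. -/
theorem lintegral_dist_le_of_almost_minimal [SFinite τ] (hα : 0 < α) (hΛ : 0 < Λ)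
    (hT : 0 < T) (hc : Measurable c) (hD : Measurable (Function.uncurry D))
    (hD2 : ∀ ω, MemLp (fun t => D t ω) 2 τ) {φ ψ : Time T → Ω → ℝ} (hφ : φ ∈ strategies τ P 𝒢)
    (hψ : ψ ∈ strategies τ P 𝒢) {I δ : ℝ≥0∞} (hI : I ≠ ∞)
    (hmin : ∀ χ ∈ strategies τ P 𝒢, I ≤ disutility τ P α Λ c D χ)
    (hφI : disutility τ P α Λ c D φ ≤ I + δ) (hψI : disutility τ P α Λ c D ψ ≤ I + δ) :
    ∫⁻ ω, ENNReal.ofReal (Real.exp (-α * (c ω + 1 / Λ * ∫ t, D t ω ^ 2 ∂τ))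
        * (1 - Real.exp (-(α * Λ / 8) * ∫ t, (φ t ω - ψ t ω) ^ 2 ∂τ))) ∂P ≤ δ := by
  have h := lintegral_dist_add_disutility_midpoint_le (P := P) hα hΛ hT hc hD hD2 hφ hψ
  have h2 := hmin _ (convexComb_mem_strategies hφ hψ (1 / 2))
  refine (ENNReal.add_le_add_iff_right hI).1 ?_
  calc _ ≤ _ := add_le_add_right h2 _
    _ ≤ _ := h
    _ ≤ ENNReal.ofReal (1 / 2) * (I + δ) + ENNReal.ofReal (1 / 2) * (I + δ) := by gcongr
    _ = δ + I := by
      rw [← add_mul, ← ENNReal.ofReal_add (by norm_num) (by norm_num)]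
      norm_num [add_comm]

/-- With δ = 0 the weighted distance integrates to zero, and the weight is positive. -/
theorem ae_eq_of_disutility_minimal [SFinite τ] [SFinite P] (hα : 0 < α) (hΛ : 0 < Λ)
    (hT : 0 < T) (hc : Measurable c) (hD : Measurable (Function.uncurry D))
    (hD2 : ∀ ω, MemLp (fun t => D t ω) 2 τ) {φ ψ : Time T → Ω → ℝ} (hφ : φ ∈ strategies τ P 𝒢)
    (hψ : ψ ∈ strategies τ P 𝒢) {I : ℝ≥0∞} (hI : I ≠ ∞)
    (hmin : ∀ χ ∈ strategies τ P 𝒢, I ≤ disutility τ P α Λ c D χ)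
    (hφI : disutility τ P α Λ c D φ ≤ I) (hψI : disutility τ P α Λ c D ψ ≤ I) :
    ∀ᵐ p ∂(τ.prod P), φ p.1 p.2 = ψ p.1 p.2 := by
  have hφm := hφ.1.measurable hT
  have hψm := hψ.1.measurable hT
  have h := lintegral_dist_le_of_almost_minimal (δ := 0) hα hΛ hT hc hD hD2 hφ hψ hI hmin
    (by simpa using hφI) (by simpa using hψI)
  have hm1 : Measurable fun ω => ∫ t, D t ω ^ 2 ∂τ :=
    measurable_integral_left (f := fun t ω => D t ω ^ 2) (hD.pow_const 2)
  have hm2 : Measurable fun ω => ∫ t, (φ t ω - ψ t ω) ^ 2 ∂τ :=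
    measurable_integral_left (f := fun t ω => (φ t ω - ψ t ω) ^ 2) ((hφm.sub hψm).pow_const 2)
  rw [nonpos_iff_eq_zero, lintegral_eq_zero_iff (by fun_prop)] at h
  have hset : MeasurableSet {p : Time T × Ω | φ p.1 p.2 = ψ p.1 p.2} :=
    measurableSet_eq_fun hφm hψm
  refine (Measure.ae_prod_mem_iff_ae_ae_mem hset).2 ?_
  refine (Measure.ae_ae_comm (p := fun t ω => φ t ω = ψ t ω) hset).2 ?_
  filter_upwards [h, hφ.2, hψ.2] with ω h1 h2 h3
  simp only [Pi.zero_apply, ENNReal.ofReal_eq_zero] at h1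
  have hx : 0 ≤ ∫ t, (φ t ω - ψ t ω) ^ 2 ∂τ := integral_nonneg fun t => sq_nonneg _
  have h4 := nonpos_of_mul_nonpos_right h1 (Real.exp_pos _)
  rw [sub_nonpos, Real.one_le_exp_iff] at h4
  have hx0 : ∫ t, (φ t ω - ψ t ω) ^ 2 ∂τ = 0 := by
    have : 0 < α * Λ / 8 := by positivity
    nlinarith
  have hint : Integrable (fun t => (φ t ω - ψ t ω) ^ 2) τ := (h2.sub h3).integrable_sq
  rw [integral_eq_zero_iff_of_nonneg (fun t => sq_nonneg _) hint] at hx0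
  filter_upwards [hx0] with t ht
  simpa [sub_eq_zero] using ht

theorem exists_disutility_minimal [SFinite τ] (hα : 0 < α) (hΛ : 0 < Λ)
    (hT : 0 < T) (hc : Measurable c) (hD : Measurable (Function.uncurry D))
    (hD2 : ∀ ω, MemLp (fun t => D t ω) 2 τ)
    (hfin : ∃ φ ∈ strategies τ P 𝒢, disutility τ P α Λ c D φ ≠ ∞) :
    ∃ φ ∈ strategies τ P 𝒢,
      ∀ ψ ∈ strategies τ P 𝒢, disutility τ P α Λ c D φ ≤ disutility τ P α Λ c D ψ := by
  set J := disutility τ P α Λ c D with hJ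
  set I := ⨅ φ ∈ strategies τ P 𝒢, J φ with hIdef
  have hmin : ∀ χ ∈ strategies τ P 𝒢, I ≤ J χ := fun χ hχ => iInf₂_le χ hχ
  have hI : I ≠ ∞ := by
    obtain ⟨φ, hφ, h⟩ := hfin
    exact ne_top_of_le_ne_top h (hmin φ hφ)
  set η : ℕ → ℝ := fun k => 1 - Real.exp (-(α * Λ / 8) * (1 / 4 : ℝ) ^ k) with hη
  have hηpos : ∀ k, 0 < η k := by
    intro k
    rw [hη, sub_pos, Real.exp_lt_one_iff, neg_mul, neg_lt_zero]
    positivity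
  have hηanti : ∀ k, η (k + 1) ≤ η k := by
    intro k
    simp only [hη]
    gcongr 1 - Real.exp ?_
    have h1 : (1 / 4 : ℝ) ^ (k + 1) ≤ (1 / 4 : ℝ) ^ k :=
      pow_le_pow_of_le_one (by norm_num) (by norm_num) (by omega)
    have h2 : 0 ≤ α * Λ / 8 := by positivity
    nlinarith
  -- The factor η k is the least value of the distance term once the squared distance exceeds
  -- 4^(-k). Markov's inequality divides it out and leaves the summable 2^(-k).
  set δ : ℕ → ℝ≥0∞ := fun k => ENNReal.ofReal (η k) * (1 / 2 : ℝ≥0∞) ^ k with hδ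
  have hδpos : ∀ k, δ k ≠ 0 := fun k => by
    simp [hδ, hηpos k]
  have hδanti : ∀ k, δ (k + 1) ≤ δ k := fun k =>
    mul_le_mul' (ENNReal.ofReal_le_ofReal (hηanti k))
      (pow_le_pow_right_of_le_one' (by simp) (by omega))
  have hδ0 : Tendsto δ atTop (𝓝 0) := by
    refine tendsto_of_tendsto_of_tendsto_of_le_of_le tendsto_const_nhds
      (ENNReal.tendsto_pow_atTop_nhds_zero_of_lt_one (r := 1 / 2) (by simp)) (fun _ => zero_le)
      fun k => ?_
    have : ENNReal.ofReal (η k) ≤ 1 := by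
      rw [ENNReal.ofReal_le_one]
      simp only [hη]; linarith [Real.exp_pos (-(α * Λ / 8) * (1 / 4 : ℝ) ^ k)]
    calc δ k ≤ 1 * (1 / 2 : ℝ≥0∞) ^ k := mul_le_mul' this le_rfl
      _ = _ := one_mul _
  have hex : ∀ k, ∃ φ ∈ strategies τ P 𝒢, J φ < I + δ k := by
    intro k
    have : I < I + δ k := ENNReal.lt_add_right hI (hδpos k)
    simpa [hIdef, iInf_lt_iff] using this
  choose φ hφ hφJ using hex
  have hφm := fun k => (hφ k).1.measurable hT
  have hdist := fun k => lintegral_dist_le_of_almost_minimal hα hΛ hT hc hD hD2 (hφ k)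
    (hφ (k + 1)) hI hmin (hφJ k).le ((hφJ (k + 1)).le.trans (add_le_add_right (hδanti k) _))
  set w : Ω → ℝ := fun ω => Real.exp (-α * (c ω + 1 / Λ * ∫ t, D t ω ^ 2 ∂τ)) with hw
  set x : ℕ → Ω → ℝ := fun k ω => ∫ t, (φ k t ω - φ (k + 1) t ω) ^ 2 ∂τ with hx
  have hm1 : Measurable fun ω => ∫ t, D t ω ^ 2 ∂τ :=
    measurable_integral_left (f := fun t ω => D t ω ^ 2) (hD.pow_const 2)
  have hm2 : ∀ k, Measurable (x k) := fun k =>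
    measurable_integral_left (f := fun t ω => (φ k t ω - φ (k + 1) t ω) ^ 2)
      (((hφm k).sub (hφm (k + 1))).pow_const 2)
  have hwm : Measurable w := by fun_prop
  -- The weight is absorbed into the measure. It is positive, so Borel–Cantelli under ν gives an
  -- almost sure statement under P.
  set ν := P.withDensity fun ω => ENNReal.ofReal (w ω) with hν
  have hPν : P ≪ ν := withDensity_absolutelyContinuous' hwm.ennreal_ofReal.aemeasurable
    (ae_of_all _ fun ω => by simp [hw, Real.exp_pos])
  have hνs : ∀ k, ν {ω | (1 / 4 : ℝ) ^ k < x k ω} ≤ (1 / 2 : ℝ≥0∞) ^ k := by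
    intro k
    have hs : MeasurableSet {ω | (1 / 4 : ℝ) ^ k < x k ω} := measurableSet_lt measurable_const (hm2 k)
    have hη0 : ENNReal.ofReal (η k) ≠ 0 := by simp [hηpos k]
    rw [← ENNReal.mul_le_mul_iff_right hη0 ENNReal.ofReal_ne_top]
    refine le_trans ?_ (hdist k)
    rw [hν, withDensity_apply _ hs, ← lintegral_const_mul _ hwm.ennreal_ofReal]
    refine le_trans (setLIntegral_mono' hs ?_) (setLIntegral_le_lintegral _ _)
    intro ω hω
    rw [← ENNReal.ofReal_mul (hηpos k).le, mul_comm]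
    refine ENNReal.ofReal_le_ofReal (mul_le_mul_of_nonneg_left ?_ (Real.exp_pos _).le)
    simp only [hη]
    gcongr 1 - Real.exp ?_
    have h2 : 0 ≤ α * Λ / 8 := by positivity
    have h3 : (1 / 4 : ℝ) ^ k < x k ω := hω
    show -(α * Λ / 8) * x k ω ≤ _
    nlinarith
  have hsum : ∑' k, ν {ω | (1 / 4 : ℝ) ^ k < x k ω} ≠ ∞ := by
    refine ne_top_of_le_ne_top ?_ (ENNReal.tsum_le_tsum hνs)
    rw [ENNReal.tsum_geometric]; simp
  have hev : ∀ᵐ ω ∂P, ∀ᶠ k in atTop, ω ∉ {ω | (1 / 4 : ℝ) ^ k < x k ω} :=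
    hPν.ae_le (ae_eventually_notMem hsum)
  have hmem : ∀ᵐ ω ∂P, ∀ k, MemLp (fun t => φ k t ω) 2 τ := ae_all_iff.2 fun k => (hφ k).2
  have hkey : ∀ᵐ ω ∂P, MemLp (fun t => limsup (fun k => φ k t ω) atTop) 2 τ ∧
      Tendsto (fun k => gain τ Λ c D (φ k) ω) atTop
        (𝓝 (gain τ Λ c D (fun t ω => limsup (fun k => φ k t ω) atTop) ω)) := by
    filter_upwards [hev, hmem] with ω h1 h2
    obtain ⟨hg, hlim⟩ := exists_toLp_tendsto_limsup_of_geometric h2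
      (h1.mono fun k hk => not_lt.1 hk)
    exact ⟨hg, tendsto_quad (hD2 ω) h2 hg hlim⟩
  have hφlim : (fun t ω => limsup (fun k => φ k t ω) atTop) ∈ strategies τ P 𝒢 := by
    refine ⟨?_, hkey.mono fun ω h => h.1⟩
    exact Measurable.limsup (f := fun k => Function.uncurry (φ k)) fun k => (hφ k).1
  refine ⟨_, hφlim, fun ψ hψ => le_trans ?_ (hmin ψ hψ)⟩
  have hJlim : Tendsto (fun k => J (φ k)) atTop (𝓝 I) := by
    refine tendsto_of_tendsto_of_tendsto_of_le_of_le tendsto_const_nhds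
      (h := fun k => I + δ k) ?_ (fun k => hmin _ (hφ k)) fun k => (hφJ k).le
    simpa using hδ0.const_add I
  rw [← hJlim.liminf_eq]
  refine le_trans (le_of_eq ?_) (lintegral_liminf_le fun k =>
    (((measurable_gain (Λ := Λ) (τ := τ) hc hD (hφm k)).const_mul (-α)).exp).ennreal_ofReal)
  refine lintegral_congr_ae ?_
  filter_upwards [hkey] with ω h
  refine (Tendsto.liminf_eq ?_).symm
  exact (ENNReal.continuous_ofReal.tendsto _).comp
    ((Real.continuous_exp.tendsto _).comp (h.2.const_mul _))

end Primal

/-! ### Relative entropy, Gibbs' inequality and the first-order condition -/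

section Entropy

variable {Ω : Type*} [mΩ : MeasurableSpace Ω] {P Q : Measure Ω}

/-- The Fenchel inequality between the conjugate functions exp u and v log v - v. -/
theorem mul_le_exp_add_mul_log_sub (u : ℝ) {v : ℝ} (hv : 0 ≤ v) :
    u * v ≤ Real.exp u + v * Real.log v - v := by
  rcases hv.eq_or_lt with rfl | hv
  · simp [(Real.exp_pos u).le]
  · have h := Real.add_one_le_exp (u - Real.log v)
    rw [Real.exp_sub, Real.exp_log hv, le_div_iff₀ hv] at h
    linarith

/-- The first-order condition at a minimum over a segment of the expected exponential. -/
theorem integrable_exp_mul_sub_and_nonneg {a b : Ω → ℝ} (ha : Measurable a) (hb : Measurable b)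
    (hea : Integrable (fun ω => Real.exp (a ω)) P) (heb : Integrable (fun ω => Real.exp (b ω)) P)
    (hmin : ∀ s ∈ Ioc (0 : ℝ) 1,
      ∫ ω, Real.exp (b ω) ∂P ≤ ∫ ω, Real.exp ((1 - s) * b ω + s * a ω) ∂P) :
    Integrable (fun ω => Real.exp (b ω) * (a ω - b ω)) P ∧
      0 ≤ ∫ ω, Real.exp (b ω) * (a ω - b ω) ∂P := by
  -- Difference quotients at 0 along the segment from b to a. Convexity bounds them above by exp a -
  -- exp b, and minimality makes their integrals nonnegative.
  set q : ℕ → Ω → ℝ := fun n ω =>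
    (n + 1 : ℝ) * (Real.exp ((1 - 1 / (n + 1 : ℝ)) * b ω + 1 / (n + 1 : ℝ) * a ω)
      - Real.exp (b ω)) with hq
  have hs : ∀ n : ℕ, 1 / (n + 1 : ℝ) ∈ Ioc (0 : ℝ) 1 := fun n =>
    ⟨by positivity, by rw [div_le_one (by positivity)]; linarith [n.cast_nonneg (α := ℝ)]⟩
  have hconv : ∀ (n : ℕ) ω, Real.exp ((1 - 1 / (n + 1 : ℝ)) * b ω + 1 / (n + 1 : ℝ) * a ω)
      ≤ (1 - 1 / (n + 1 : ℝ)) * Real.exp (b ω) + 1 / (n + 1 : ℝ) * Real.exp (a ω) := fun n ω =>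
    convexOn_exp.2 (mem_univ (b ω)) (mem_univ (a ω)) (sub_nonneg.2 (hs n).2) (hs n).1.le (by ring)
  have hqle : ∀ n ω, q n ω ≤ Real.exp (a ω) - Real.exp (b ω) := by
    intro n ω
    have h := hconv n ω
    have hn : (0 : ℝ) < n + 1 := by positivity
    calc q n ω ≤ (n + 1 : ℝ) * (((1 - 1 / (n + 1 : ℝ)) * Real.exp (b ω)
          + 1 / (n + 1 : ℝ) * Real.exp (a ω)) - Real.exp (b ω)) := by
          simp only [hq]; gcongr
      _ = _ := by field_simp; ring
  have hei : ∀ n : ℕ, Integrable (fun ω =>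
      Real.exp ((1 - 1 / (n + 1 : ℝ)) * b ω + 1 / (n + 1 : ℝ) * a ω)) P := by
    intro n
    refine ((heb.const_mul (1 - 1 / (n + 1 : ℝ))).add (hea.const_mul (1 / (n + 1 : ℝ)))).mono'
      (by fun_prop) (ae_of_all _ fun ω => ?_)
    rw [Real.norm_of_nonneg (Real.exp_pos _).le]
    exact hconv n ω
  have hqi : ∀ n, Integrable (q n) P := fun n => ((hei n).sub heb).const_mul _
  have hq0 : ∀ n, 0 ≤ ∫ ω, q n ω ∂P := by
    intro n
    simp only [hq]
    rw [integral_const_mul, integral_sub (hei n) heb]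
    exact mul_nonneg (by positivity) (sub_nonneg.2 (hmin _ (hs n)))
  have hlim : ∀ ω, Tendsto (fun n => q n ω) atTop (𝓝 (Real.exp (b ω) * (a ω - b ω))) := by
    intro ω
    have hder : HasDerivAt (fun s : ℝ => Real.exp ((1 - s) * b ω + s * a ω))
        (Real.exp (b ω) * (a ω - b ω)) 0 := by
      have h1 : HasDerivAt (fun s : ℝ => (1 - s) * b ω + s * a ω) (a ω - b ω) 0 := by
        have := (((hasDerivAt_id (0 : ℝ)).const_sub 1).mul_const (b ω)).add
          ((hasDerivAt_id (0 : ℝ)).mul_const (a ω))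
        refine this.congr_deriv ?_
        ring
      simpa using h1.exp
    have hseq : Tendsto (fun n : ℕ => 1 / (n + 1 : ℝ)) atTop (𝓝[≠] 0) :=
      tendsto_nhdsWithin_iff.2 ⟨tendsto_one_div_add_atTop_nhds_zero_nat,
        Eventually.of_forall fun n => (hs n).1.ne'⟩
    refine ((hasDerivAt_iff_tendsto_slope_zero.1 hder).comp hseq).congr fun n => ?_
    simp [hq]
  -- Fatou's lemma is applied to the nonnegative gaps exp a - exp b - q n, whose limit is g. This
  -- yields both integrability and the sign, without any lower bound on the quotients.
  set g : Ω → ℝ := fun ω => Real.exp (a ω) - Real.exp (b ω) - Real.exp (b ω) * (a ω - b ω) with hg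
  have hg0 : ∀ ω, 0 ≤ g ω := fun ω =>
    sub_nonneg.2 (le_of_tendsto (hlim ω) (Eventually.of_forall fun n => hqle n ω))
  have hab : Integrable (fun ω => Real.exp (a ω) - Real.exp (b ω)) P := hea.sub heb
  have hI0 : 0 ≤ ∫ ω, (Real.exp (a ω) - Real.exp (b ω)) ∂P := by
    rw [integral_sub hea heb, sub_nonneg]
    simpa using hmin 1 ⟨one_pos, le_rfl⟩
  have hgl : ∫⁻ ω, ENNReal.ofReal (g ω) ∂P
      ≤ ENNReal.ofReal (∫ ω, (Real.exp (a ω) - Real.exp (b ω)) ∂P) := by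
    have hF := lintegral_liminf_le (μ := P) (u := atTop)
      (f := fun n ω => ENNReal.ofReal (Real.exp (a ω) - Real.exp (b ω) - q n ω))
      (fun n => by simp only [hq]; fun_prop)
    have e1 : ∀ ω, liminf (fun n => ENNReal.ofReal (Real.exp (a ω) - Real.exp (b ω) - q n ω)) atTop
        = ENNReal.ofReal (g ω) := fun ω =>
      (ENNReal.tendsto_ofReal ((hlim ω).const_sub _)).liminf_eq
    simp only [e1] at hF
    refine hF.trans (liminf_le_of_frequently_le' (Frequently.of_forall fun n => ?_))
    have hsub : Integrable (fun ω => Real.exp (a ω) - Real.exp (b ω) - q n ω) P := hab.sub (hqi n)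
    rw [← ofReal_integral_eq_lintegral_ofReal hsub
      (ae_of_all _ fun ω => sub_nonneg.2 (hqle n ω))]
    refine ENNReal.ofReal_le_ofReal ?_
    rw [integral_sub hab (hqi n)]
    linarith [hq0 n]
  have hgi : Integrable g P := by
    refine ⟨by fun_prop, ?_⟩
    rw [hasFiniteIntegral_iff_ofReal (ae_of_all _ hg0)]
    exact hgl.trans_lt ENNReal.ofReal_lt_top
  have hgI : ∫ ω, g ω ∂P ≤ ∫ ω, (Real.exp (a ω) - Real.exp (b ω)) ∂P := by
    rw [← ofReal_integral_eq_lintegral_ofReal hgi (ae_of_all _ hg0)] at hgl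
    exact (ENNReal.ofReal_le_ofReal_iff hI0).1 hgl
  have hEq : (fun ω => Real.exp (b ω) * (a ω - b ω))
      = fun ω => (Real.exp (a ω) - Real.exp (b ω)) - g ω := by
    ext ω; simp only [hg]; ring
  rw [hEq]
  refine ⟨hab.sub hgi, ?_⟩
  rw [integral_sub hab hgi]
  linarith

variable [IsProbabilityMeasure P]

/-- Random variables with an exponential moment are integrable under measures of finite entropy. -/
theorem integrable_of_integrable_exp (hQ : Q ∈ finiteEntropy P) {X : Ω → ℝ} (hX : Measurable X)
    (h0 : ∀ ω, 0 ≤ X ω) (hexp : Integrable (fun ω => Real.exp (X ω)) P) : Integrable X Q := by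
  obtain ⟨hQ1, hQP, -, hllr⟩ := hQ
  rw [← integrable_rnDeriv_smul_iff hQP]
  refine (hexp.add ((integrable_rnDeriv_mul_log_iff hQP).2 hllr)).mono'
    (by fun_prop) (ae_of_all _ fun ω => ?_)
  have h := mul_le_exp_add_mul_log_sub (X ω) (ENNReal.toReal_nonneg (a := Q.rnDeriv P ω))
  have h2 : 0 ≤ (Q.rnDeriv P ω).toReal := ENNReal.toReal_nonneg
  rw [smul_eq_mul, Real.norm_of_nonneg (mul_nonneg h2 (h0 ω))]
  simp only [Pi.add_apply]
  linarith

/-- Gibbs' variational inequality. -/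
theorem integral_le_of_finiteEntropy (hQ : Q ∈ finiteEntropy P) {b : Ω → ℝ} (hbQ : Integrable b Q)
    (hexp : Integrable (fun ω => Real.exp (b ω)) P) :
    ∫ ω, b ω ∂Q ≤ ∫ ω, llr Q P ω ∂Q + Real.log (∫ ω, Real.exp (b ω) ∂P) := by
  obtain ⟨hQ1, hQP, -, hllr⟩ := hQ
  have := isProbabilityMeasure_tilted hexp
  have hac : Q ≪ P.tilted b := hQP.trans (absolutelyContinuous_tilted hexp)
  -- The divergence of Q from the tilted measure is the entropy minus E_Q[b] plus the
  -- log-normalizer; it is nonnegative.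
  have h := integral_llr_tilted_right hQP hbQ hexp hllr
  have h2 := InformationTheory.toReal_klDiv_of_measure_eq hac (by simp)
  have h3 : 0 ≤ (InformationTheory.klDiv Q (P.tilted b)).toReal := ENNReal.toReal_nonneg
  linarith

/-- The case of equality in Gibbs' variational inequality. -/
theorem eq_tilted_of_integral_eq (hQ : Q ∈ finiteEntropy P) {b : Ω → ℝ} (hbQ : Integrable b Q)
    (hexp : Integrable (fun ω => Real.exp (b ω)) P)
    (heq : ∫ ω, llr Q P ω ∂Q + Real.log (∫ ω, Real.exp (b ω) ∂P) ≤ ∫ ω, b ω ∂Q) :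
    Q = P.tilted b := by
  obtain ⟨hQ1, hQP, -, hllr⟩ := hQ
  have := isProbabilityMeasure_tilted hexp
  have hac : Q ≪ P.tilted b := hQP.trans (absolutelyContinuous_tilted hexp)
  have h := integral_llr_tilted_right hQP hbQ hexp hllr
  have h2 := InformationTheory.toReal_klDiv_of_measure_eq hac (by simp)
  have h3 : 0 ≤ (InformationTheory.klDiv Q (P.tilted b)).toReal := ENNReal.toReal_nonneg
  have h4 : InformationTheory.klDiv Q (P.tilted b) ≠ ∞ :=
    InformationTheory.klDiv_ne_top hac (integrable_llr_tilted_right hQP hbQ hllr hexp)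
  have h5 : (InformationTheory.klDiv Q (P.tilted b)).toReal = 0 := by linarith
  rw [ENNReal.toReal_eq_zero_iff, or_iff_left h4] at h5
  exact InformationTheory.klDiv_eq_zero_iff.1 h5

theorem llr_tilted_self {b : Ω → ℝ} (hexp : Integrable (fun ω => Real.exp (b ω)) P) :
    llr (P.tilted b) P =ᵐ[P] fun ω => b ω - Real.log (∫ ω, Real.exp (b ω) ∂P) :=
  log_rnDeriv_tilted_left_self hexp

theorem tilted_mem_finiteEntropy {b : Ω → ℝ} (hexp : Integrable (fun ω => Real.exp (b ω)) P)
    (hb : Integrable (fun ω => Real.exp (b ω) * b ω) P) : P.tilted b ∈ finiteEntropy P := by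
  have := isProbabilityMeasure_tilted hexp
  refine ⟨this, tilted_absolutelyContinuous P b, absolutelyContinuous_tilted hexp, ?_⟩
  rw [integrable_congr ((tilted_absolutelyContinuous P b).ae_le (llr_tilted_self hexp))]
  exact ((integrable_tilted_iff hexp _).2 hb).sub (integrable_const _)

/-- From below, b exp b ≥ -1. From above, the Fenchel inequality is used at 2a rather than a:
subtracting 2b exp b from both sides then leaves one copy of b exp b to be bounded. -/
theorem integrable_exp_mul_self {a b : Ω → ℝ} (hb : Measurable b)
    (hea : Integrable (fun ω => Real.exp (2 * a ω)) P)
    (hab : Integrable (fun ω => Real.exp (b ω) * (a ω - b ω)) P) :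
    Integrable (fun ω => Real.exp (b ω) * b ω) P := by
  refine ((hab.abs.const_mul 2).add (hea.add (integrable_const 1))).mono' (by fun_prop)
    (ae_of_all _ fun ω => ?_)
  have h1 := mul_le_exp_add_mul_log_sub (2 * a ω) (Real.exp_pos (b ω)).le
  rw [Real.log_exp] at h1
  have h2 : -(Real.exp (b ω) * b ω) ≤ 1 := by
    have h3 := Real.add_one_le_exp (-b ω)
    have h4 : Real.exp (b ω) * Real.exp (-b ω) = 1 := by rw [← Real.exp_add]; simp
    nlinarith [Real.exp_pos (b ω)]
  have h5 := neg_abs_le (Real.exp (b ω) * (a ω - b ω))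
  have h6 := abs_nonneg (Real.exp (b ω) * (a ω - b ω))
  have h7 := Real.exp_pos (2 * a ω)
  have h8 := Real.exp_pos (b ω)
  rw [Real.norm_eq_abs]
  simp only [Pi.add_apply]
  exact abs_le.2 ⟨by linarith, by linarith⟩

end Entropy

/-! ### Càdlàg regularization of a single path through upcrossings -/

section Regularization

variable {Ω : Type*} {T : ℝ}

/-- The points of the dyadic grids. -/
def gridPoints (hT : 0 < T) : Set (Time T) := {t | ∃ n k, grid hT n k = t}

/-- The discrete-time process of the values on the `n`-th dyadic grid. -/
noncomputable def onGrid (hT : 0 < T) (M : Time T → Ω → ℝ) (n : ℕ) : ℕ → Ω → ℝ :=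
  fun k => M (grid hT n k)

theorem eventually_exists_grid_eq {hT : 0 < T} {t : Time T} (ht : t ∈ gridPoints hT) :
    ∀ᶠ n in atTop, ∃ k, grid hT n k = t := by
  obtain ⟨n, k, rfl⟩ := ht
  filter_upwards [eventually_ge_atTop n] with m hm
  exact exists_grid_eq_of_le hT hm k

/-- On all fine grids, at least `K` upcrossings are completed between `u` and `v`. -/
def CrossesBetween (hT : 0 < T) (M : Time T → Ω → ℝ) (ω : Ω) (a b : ℝ) (K : ℕ) (u v : Time T) :
    Prop :=
  ∀ᶠ n in atTop, ∀ i, grid hT n i ≤ u → ∃ j, grid hT n j ≤ v ∧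
    upcrossingsBefore a b (onGrid hT M n) (i + 1) ω + K
      ≤ upcrossingsBefore a b (onGrid hT M n) (j + 1) ω

variable {hT : 0 < T} {M : Time T → Ω → ℝ} {ω : Ω} {a b : ℝ}

theorem crossesBetween_zero (u : Time T) : CrossesBetween hT M ω a b 0 u u :=
  Eventually.of_forall fun _ i hi => ⟨i, hi, le_rfl⟩

theorem CrossesBetween.trans {K L : ℕ} {u v w : Time T} (h1 : CrossesBetween hT M ω a b K u v)
    (h2 : CrossesBetween hT M ω a b L v w) : CrossesBetween hT M ω a b (K + L) u w := by
  filter_upwards [h1, h2] with n h1 h2 i hi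
  obtain ⟨j, hj, hij⟩ := h1 i hi
  obtain ⟨k, hk, hjk⟩ := h2 j hj
  exact ⟨k, hk, by omega⟩

/-- As `upcrossingsBefore` counts upcrossings completed strictly before its bound, the index i + 1
includes grid time i. The strict order u < s puts the new upcrossing after everything already
counted at u. -/
theorem crossesBetween_one (hab : a < b) {u s s' : Time T} (hs : s ∈ gridPoints hT)
    (hs' : s' ∈ gridPoints hT) (hus : u < s) (hss' : s < s') (ha : M s ω < a) (hb : b < M s' ω) :
    CrossesBetween hT M ω a b 1 u s' := by
  filter_upwards [eventually_exists_grid_eq hs, eventually_exists_grid_eq hs'] with n h1 h2 i hi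
  obtain ⟨k, rfl⟩ := h1
  obtain ⟨k', rfl⟩ := h2
  have hik : i < k := (grid_mono hT n).reflect_lt (hi.trans_lt hus)
  have hkk' : k < k' := (grid_mono hT n).reflect_lt hss'
  exact ⟨k', le_rfl, upcrossingsBefore_lt_of_exists_upcrossing hab hik ha hkk'.le hb⟩

theorem CrossesBetween.eventually_le_upcrossings {K : ℕ} {u v : Time T}
    (h : CrossesBetween hT M ω a b K u v) :
    ∀ᶠ n in atTop, (K : ℝ≥0∞) ≤ upcrossings a b (onGrid hT M n) ω := by
  filter_upwards [h] with n h
  obtain ⟨j, -, hj⟩ := h 0 (by rw [grid_zero]; exact u.2.1)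
  refine le_trans ?_ (le_iSup _ (j + 1))
  exact_mod_cast (by omega : K ≤ upcrossingsBefore a b (onGrid hT M n) (j + 1) ω)

theorem exists_of_frequently_nhdsWithin {p : Time T → Prop} {t : Time T} {A D U : Set (Time T)}
    (h : ∃ᶠ s in 𝓝[A ∩ D] t, p s) (hU : U ∈ 𝓝 t) : ∃ s ∈ A, s ∈ D ∧ s ∈ U ∧ p s := by
  obtain ⟨s, hs, hp⟩ := (h.and_eventually
    (inter_mem self_mem_nhdsWithin (mem_nhdsWithin_of_mem_nhds hU))).exists
  exact ⟨s, hp.1.1, hp.1.2, hp.2, hs⟩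

/-- Each induction step appends one more upcrossing closer to t, after the earlier ones. -/
theorem exists_crossesBetween_of_frequently_left (hab : a < b) {t : Time T}
    (h1 : ∃ᶠ s in 𝓝[Iio t ∩ gridPoints hT] t, M s ω < a)
    (h2 : ∃ᶠ s in 𝓝[Iio t ∩ gridPoints hT] t, b < M s ω) (K : ℕ) :
    ∃ u v, v < t ∧ CrossesBetween hT M ω a b K u v := by
  induction K with
  | zero =>
    obtain ⟨s, hs, -⟩ := exists_of_frequently_nhdsWithin h1 univ_mem
    exact ⟨s, s, hs, crossesBetween_zero s⟩
  | succ K ih =>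
    obtain ⟨u, v, hv, hC⟩ := ih
    obtain ⟨s, hst, hsD, hvs, hsa⟩ := exists_of_frequently_nhdsWithin h1 (Ioi_mem_nhds hv)
    obtain ⟨s', hst', hsD', hss', hsb⟩ := exists_of_frequently_nhdsWithin h2 (Ioi_mem_nhds hst)
    exact ⟨u, s', hst', hC.trans (crossesBetween_one hab hsD hsD' hvs hss' hsa hsb)⟩

/-- Approaching t from the right, new upcrossings are found before the earlier ones, so they are
prepended and their points are chosen in reverse order. -/
theorem exists_crossesBetween_of_frequently_right (hab : a < b) {t : Time T}
    (h1 : ∃ᶠ s in 𝓝[Ioi t ∩ gridPoints hT] t, M s ω < a)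
    (h2 : ∃ᶠ s in 𝓝[Ioi t ∩ gridPoints hT] t, b < M s ω) (K : ℕ) :
    ∃ u v, t < u ∧ CrossesBetween hT M ω a b K u v := by
  induction K with
  | zero =>
    obtain ⟨s, hs, -⟩ := exists_of_frequently_nhdsWithin h1 univ_mem
    exact ⟨s, s, hs, crossesBetween_zero s⟩
  | succ K ih =>
    obtain ⟨u, v, hu, hC⟩ := ih
    obtain ⟨s', hts', hsD', hsu', hsb⟩ := exists_of_frequently_nhdsWithin h2 (Iio_mem_nhds hu)
    obtain ⟨s, hts, hsD, hss', hsa⟩ := exists_of_frequently_nhdsWithin h1 (Iio_mem_nhds hts')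
    obtain ⟨r, htr, -, hrs, -⟩ := exists_of_frequently_nhdsWithin h1 (Iio_mem_nhds hts)
    refine ⟨r, v, htr, ?_⟩
    have h3 : CrossesBetween hT M ω a b 1 r u :=
      (crossesBetween_one hab hsD hsD' hrs hss' hsa hsb).mono fun n hn i hi => by
        obtain ⟨j, hj, h⟩ := hn i hi
        exact ⟨j, hj.trans hsu'.le, h⟩
    rw [add_comm]
    exact h3.trans hC

/-- Without a one-sided limit a bounded path oscillates across some rational interval, which forces
arbitrarily many upcrossings on all fine grids. -/
theorem exists_tendsto_of_liminf_upcrossings_lt_top {C : ℝ}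
    (hC : ∀ t ∈ gridPoints hT, |M t ω| ≤ C)
    (hup : ∀ a b : ℚ, a < b → liminf (fun n => upcrossings a b (onGrid hT M n) ω) atTop < ∞)
    (t : Time T) :
    (∃ l, Tendsto (fun s => M s ω) (𝓝[Ioi t ∩ gridPoints hT] t) (𝓝 l)) ∧
      ∃ l, Tendsto (fun s => M s ω) (𝓝[Iio t ∩ gridPoints hT] t) (𝓝 l) := by
  have key : ∀ A : Set (Time T), (∀ a b : ℝ, a < b →
        (∃ᶠ s in 𝓝[A ∩ gridPoints hT] t, M s ω < a) →
        (∃ᶠ s in 𝓝[A ∩ gridPoints hT] t, b < M s ω) →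
        ∀ K, ∃ u v, CrossesBetween hT M ω a b K u v) →
      ∃ l, Tendsto (fun s => M s ω) (𝓝[A ∩ gridPoints hT] t) (𝓝 l) := by
    intro A hA
    have hb : ∀ᶠ s in 𝓝[A ∩ gridPoints hT] t, |M s ω| ≤ C :=
      eventually_mem_nhdsWithin.mono fun s hs => hC s hs.2
    refine tendsto_of_no_upcrossings Rat.denseRange_cast ?_
      ⟨C, eventually_map.2 (hb.mono fun s hs => (abs_le.1 hs).2)⟩
      ⟨-C, eventually_map.2 (hb.mono fun s hs => (abs_le.1 hs).1)⟩
    rintro _ ⟨a, rfl⟩ _ ⟨b, rfl⟩ hab ⟨h1, h2⟩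
    refine (hup a b (Rat.cast_lt.1 hab)).ne (ENNReal.eq_top_of_forall_nnreal_le fun r => ?_)
    obtain ⟨K, hK⟩ := exists_nat_ge r
    obtain ⟨u, v, hC⟩ := hA a b hab h1 h2 K
    refine le_trans ?_ (le_liminf_of_le (by isBoundedDefault) hC.eventually_le_upcrossings)
    exact_mod_cast hK
  refine ⟨key _ fun a b hab h1 h2 K => ?_, key _ fun a b hab h1 h2 K => ?_⟩
  · obtain ⟨u, v, -, h⟩ := exists_crossesBetween_of_frequently_right hab h1 h2 K
    exact ⟨u, v, h⟩
  · obtain ⟨u, v, -, h⟩ := exists_crossesBetween_of_frequently_left hab h1 h2 K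
    exact ⟨u, v, h⟩

theorem gridAfter_mem_gridPoints (hT : 0 < T) (n : ℕ) (t : Time T) :
    gridAfter hT n t ∈ gridPoints hT := ⟨n, _, rfl⟩

/-- Each g u is a limit of values of f at grid points that eventually stay in the open set U ∩ A, so
a closed neighbourhood of l containing those values also contains g u. -/
theorem tendsto_of_tendsto_gridAfter {f g : Time T → ℝ}
    (hg : ∀ u, Tendsto (fun n => f (gridAfter hT n u)) atTop (𝓝 (g u))) {t : Time T}
    {A : Set (Time T)} (hA : IsOpen A) {l : ℝ}
    (hl : Tendsto f (𝓝[A ∩ gridPoints hT] t) (𝓝 l)) : Tendsto g (𝓝[A] t) (𝓝 l) := by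
  refine (closed_nhds_basis l).tendsto_right_iff.2 fun V hV => ?_
  obtain ⟨U, hU, htU, hUV⟩ := mem_nhdsWithin.1 (hl hV.1)
  refine mem_nhdsWithin.2 ⟨U, hU, htU, fun u hu => ?_⟩
  refine hV.2.mem_of_tendsto (hg u) ?_
  filter_upwards [(tendsto_gridAfter hT u).eventually ((hU.inter hA).mem_nhds hu)] with n hn
  exact hUV ⟨hn.1, hn.2, gridAfter_mem_gridPoints hT n u⟩

theorem isCadlagPath_of_tendsto_gridAfter {f g : Time T → ℝ}
    (hg : ∀ u, Tendsto (fun n => f (gridAfter hT n u)) atTop (𝓝 (g u)))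
    (hr : ∀ t, ∃ l, Tendsto f (𝓝[Ioi t ∩ gridPoints hT] t) (𝓝 l))
    (hl : ∀ t, ∃ l, Tendsto f (𝓝[Iio t ∩ gridPoints hT] t) (𝓝 l)) : IsCadlagPath g := by
  intro t
  refine ⟨?_, ?_⟩
  · obtain ⟨l, hl⟩ := hr t
    rw [← continuousWithinAt_Ioi_iff_Ici, ContinuousWithinAt]
    by_cases ht : (t : ℝ) < T
    · have : Tendsto (fun n => f (gridAfter hT n t)) atTop (𝓝 l) :=
        hl.comp (tendsto_nhdsWithin_iff.2 ⟨tendsto_gridAfter hT t, Eventually.of_forall fun n =>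
          ⟨lt_gridAfter hT n ht, gridAfter_mem_gridPoints hT n t⟩⟩)
      rw [tendsto_nhds_unique (hg t) this]
      exact tendsto_of_tendsto_gridAfter hg isOpen_Ioi hl
    · have : Ioi t = ∅ := by
        ext s
        simpa using Subtype.coe_le_coe.1 (s.2.2.trans (not_lt.1 ht))
      simp [this]
  · obtain ⟨l, hl⟩ := hl t
    exact ⟨l, tendsto_of_tendsto_gridAfter hg isOpen_Iio hl⟩

end Regularization

/-! ### Càdlàg versions of conditional expectations -/

section CadlagVersion

variable {Ω : Type*} [mΩ : MeasurableSpace Ω] {T : ℝ} {P Q : Measure Ω} [IsProbabilityMeasure Q]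
  {𝒢 : Filtration (Time T) mΩ} {X : Ω → ℝ}

/-- The filtration along a dyadic grid. -/
noncomputable def gridFiltration (hT : 0 < T) (𝒢 : Filtration (Time T) mΩ) (n : ℕ) :
    Filtration ℕ mΩ where
  seq k := 𝒢 (grid hT n k)
  mono' _ _ h := 𝒢.mono (grid_mono hT n h)
  le' _ := 𝒢.le _

theorem martingale_onGrid (hT : 0 < T) (n : ℕ) :
    Martingale (onGrid hT (fun t => Q[X | 𝒢 t]) n) (gridFiltration hT 𝒢 n) Q :=
  martingale_condExp X (gridFiltration hT 𝒢 n) Q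

/-- Doob's upcrossing inequality; the L¹ contraction of conditional expectation makes the bound
independent of the grid. -/
theorem lintegral_upcrossings_onGrid_le (hT : 0 < T) (a b : ℝ) (n : ℕ) :
    ENNReal.ofReal (b - a) * ∫⁻ ω, upcrossings a b (onGrid hT (fun t => Q[X | 𝒢 t]) n) ω ∂Q
      ≤ eLpNorm X 1 Q + ‖a‖ₑ := by
  refine ((martingale_onGrid hT n).submartingale.mul_lintegral_upcrossings_le_lintegral_pos_part
    a b).trans (iSup_le fun N => ?_)
  calc ∫⁻ ω, ENNReal.ofReal ((onGrid hT (fun t => Q[X | 𝒢 t]) n N ω - a)⁺) ∂Q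
      ≤ ∫⁻ ω, (‖(Q[X | 𝒢 (grid hT n N)]) ω‖ₑ + ‖a‖ₑ) ∂Q := by
        refine lintegral_mono fun ω => ?_
        refine le_trans ?_ (enorm_sub_le (a := (Q[X | 𝒢 (grid hT n N)]) ω) (b := a))
        rw [← ofReal_norm]
        refine ENNReal.ofReal_le_ofReal (max_le (le_abs_self _) (abs_nonneg _))
    _ = eLpNorm (Q[X | 𝒢 (grid hT n N)]) 1 Q + ‖a‖ₑ := by
        rw [lintegral_add_right _ measurable_const, eLpNorm_one_eq_lintegral_enorm]
        simp
    _ ≤ _ := by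
        gcongr
        exact eLpNorm_condExp_le_eLpNorm X le_rfl

theorem ae_liminf_upcrossings_onGrid_lt_top (hT : 0 < T) (hX : Integrable X Q) :
    ∀ᵐ ω ∂Q, ∀ a b : ℚ, a < b →
      liminf (fun n => upcrossings a b (onGrid hT (fun t => Q[X | 𝒢 t]) n) ω) atTop < ∞ := by
  refine ae_all_iff.2 fun a => ae_all_iff.2 fun b => ?_
  by_cases hab : a < b
  swap
  · exact ae_of_all _ fun ω h => absurd h hab
  have hab' : (a : ℝ) < b := Rat.cast_lt.2 hab
  have hm : ∀ n, Measurable (upcrossings a b (onGrid hT (fun t => Q[X | 𝒢 t]) n)) := fun n =>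
    (martingale_onGrid hT n).submartingale.stronglyAdapted.measurable_upcrossings hab'
  have hne : ENNReal.ofReal ((b : ℝ) - a) ≠ 0 := by simpa using hab
  have hbound : ∫⁻ ω, liminf (fun n =>
      upcrossings a b (onGrid hT (fun t => Q[X | 𝒢 t]) n) ω) atTop ∂Q
      ≤ (eLpNorm X 1 Q + ‖(a : ℝ)‖ₑ) / ENNReal.ofReal (b - a) := by
    refine (lintegral_liminf_le hm).trans
      (liminf_le_of_frequently_le' (Frequently.of_forall fun n => ?_))
    rw [ENNReal.le_div_iff_mul_le (Or.inl hne) (Or.inl ENNReal.ofReal_ne_top), mul_comm]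
    exact lintegral_upcrossings_onGrid_le hT a b n
  have hfin : (eLpNorm X 1 Q + ‖(a : ℝ)‖ₑ) / ENNReal.ofReal (b - a) ≠ ∞ :=
    (ENNReal.div_lt_top (ENNReal.add_ne_top.2
      ⟨(memLp_one_iff_integrable.2 hX).eLpNorm_ne_top, enorm_ne_top⟩) hne).ne
  filter_upwards [ae_lt_top (Measurable.liminf hm) (ne_top_of_le_ne_top hfin hbound)] with ω h _
  exact h

/-- Doob's maximal inequality for the submartingale |M| = M ⊔ -M on each grid, followed by the
increasing union over the nested grids. -/
theorem measure_exists_gridPoints_le (hT : 0 < T) {r : NNReal} :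
    (r : ℝ≥0∞) * Q {ω | ∃ t ∈ gridPoints hT, (r : ℝ) ≤ |(Q[X | 𝒢 t]) ω|} ≤ eLpNorm X 1 Q := by
  set A : ℕ → Set Ω := fun n => {ω | ∃ k ≤ 2 ^ n, (r : ℝ) ≤ |(Q[X | 𝒢 (grid hT n k)]) ω|} with hA
  have hmono : Monotone A := by
    intro n m hnm ω ⟨k, hk, h⟩
    obtain ⟨i, rfl⟩ := Nat.exists_eq_add_of_le hnm
    refine ⟨k * 2 ^ i, ?_, by rwa [grid_refine]⟩
    rw [pow_add]; gcongr
  have hsub : {ω | ∃ t ∈ gridPoints hT, (r : ℝ) ≤ |(Q[X | 𝒢 t]) ω|} ⊆ ⋃ n, A n := by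
    rintro ω ⟨t, ⟨n, k, rfl⟩, h⟩
    refine mem_iUnion.2 ⟨n, min k (2 ^ n), min_le_right _ _, ?_⟩
    have : grid hT n (min k (2 ^ n)) = grid hT n k := by
      rcases le_total k (2 ^ n) with h | h
      · rw [min_eq_left h]
      · rw [min_eq_right h]
        refine le_antisymm (grid_mono hT n h) (Subtype.coe_le_coe.1 ((grid hT n k).2.2.trans ?_))
        simp [grid]
    rwa [this]
  have hAn : ∀ n, (r : ℝ≥0∞) * Q (A n) ≤ eLpNorm X 1 Q := by
    intro n
    have hmart := martingale_onGrid (Q := Q) (X := X) (𝒢 := 𝒢) hT n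
    have hsm := hmart.submartingale.sup hmart.neg.submartingale
    have habs : ∀ k ω, (onGrid hT (fun t => Q[X | 𝒢 t]) n ⊔ -onGrid hT (fun t => Q[X | 𝒢 t]) n) k ω
        = |(Q[X | 𝒢 (grid hT n k)]) ω| := fun k ω => rfl
    have h := maximal_ineq hsm (fun k ω => by rw [habs]; exact abs_nonneg _) (ε := r) (2 ^ n)
    have hset : A n = {ω | (r : ℝ) ≤ (Finset.range (2 ^ n + 1)).sup' Finset.nonempty_range_add_one
        fun k => (onGrid hT (fun t => Q[X | 𝒢 t]) n ⊔ -onGrid hT (fun t => Q[X | 𝒢 t]) n) k ω} := by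
      ext ω
      simp [hA, habs, Finset.le_sup'_iff]
    rw [hset]
    refine h.trans (le_trans ?_ (eLpNorm_condExp_le_eLpNorm (m := 𝒢 (grid hT n (2 ^ n))) X le_rfl))
    rw [eLpNorm_one_eq_lintegral_enorm]
    have hint : Integrable (fun ω => |(Q[X | 𝒢 (grid hT n (2 ^ n))]) ω|) Q := integrable_condExp.abs
    simp only [habs]
    refine (ENNReal.ofReal_le_ofReal (setIntegral_le_integral hint
      (ae_of_all _ fun ω => abs_nonneg _))).trans (le_of_eq ?_)
    rw [ofReal_integral_eq_lintegral_ofReal hint (ae_of_all _ fun ω => abs_nonneg _)]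
    simp_rw [← Real.norm_eq_abs, ofReal_norm]
  calc _ ≤ (r : ℝ≥0∞) * Q (⋃ n, A n) := by gcongr
    _ = ⨆ n, (r : ℝ≥0∞) * Q (A n) := by rw [hmono.measure_iUnion, ENNReal.mul_iSup]
    _ ≤ _ := iSup_le hAn

theorem ae_exists_forall_gridPoints_abs_le (hT : 0 < T) (hX : Integrable X Q) :
    ∀ᵐ ω ∂Q, ∃ C : ℝ, ∀ t ∈ gridPoints hT, |(Q[X | 𝒢 t]) ω| ≤ C := by
  rw [ae_iff]
  have hfin : eLpNorm X 1 Q ≠ ∞ := (memLp_one_iff_integrable.2 hX).eLpNorm_ne_top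
  have hle : ∀ n : ℕ, Q {ω | ¬ ∃ C : ℝ, ∀ t ∈ gridPoints hT, |(Q[X | 𝒢 t]) ω| ≤ C}
      ≤ eLpNorm X 1 Q / n := by
    intro n
    -- For n = 0 the right-hand side is ∞ unless the norm vanishes, where 0/0 = 0 and the maximal
    -- inequality at level 1 takes over.
    rcases n.eq_zero_or_pos with rfl | hn
    · by_cases h0 : eLpNorm X 1 Q = 0
      · have h1 := measure_exists_gridPoints_le (X := X) (Q := Q) (𝒢 := 𝒢) hT (r := 1)
        rw [h0] at h1
        simp only [ENNReal.coe_one, one_mul, nonpos_iff_eq_zero] at h1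
        refine le_trans (measure_mono fun ω hω => ?_) (h1.le.trans zero_le)
        simp only [not_exists, not_forall, not_le, mem_ofPred_eq] at hω
        obtain ⟨t, ht, h⟩ := hω 1
        exact ⟨t, ht, by simpa using h.le⟩
      · simp [ENNReal.div_zero h0]
    rw [ENNReal.le_div_iff_mul_le (by simp [hn.ne']) (by simp), mul_comm]
    refine le_trans ?_ (measure_exists_gridPoints_le (X := X) (Q := Q) (𝒢 := 𝒢) hT (r := n))
    rw [ENNReal.coe_natCast]
    gcongr
    intro hω
    simp only [not_exists, not_forall, not_le] at hω
    obtain ⟨t, ht, h⟩ := hω n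
    exact ⟨t, ht, by simpa using h.le⟩
  refine le_antisymm (ge_of_tendsto' (f := fun n : ℕ => eLpNorm X 1 Q / n) (x := atTop) ?_ hle) zero_le
  simpa using ENNReal.Tendsto.const_div ENNReal.tendsto_nat_nhds_top (Or.inr hfin)

/-- Under the usual conditions, the martingale `E_Q[X | 𝒢 t]` has a càdlàg adapted version. -/
theorem exists_isMartingaleVersion (hT : 0 < T) (h𝒢 : UsualConditions P 𝒢) (hPQ : P ≪ Q)
    (hX : Integrable X Q) : ∃ M, IsMartingaleVersion Q 𝒢 X M := by
  classical
  set N : Time T → Ω → ℝ := fun t => Q[X | 𝒢 t] with hN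
  set G : Set Ω := {ω | ∀ t,
    (∃ l, Tendsto (fun s => N s ω) (𝓝[Ioi t ∩ gridPoints hT] t) (𝓝 l)) ∧
      ∃ l, Tendsto (fun s => N s ω) (𝓝[Iio t ∩ gridPoints hT] t) (𝓝 l)} with hG
  have hGae : ∀ᵐ ω ∂Q, ω ∈ G := by
    filter_upwards [ae_exists_forall_gridPoints_abs_le (𝒢 := 𝒢) hT hX,
      ae_liminf_upcrossings_onGrid_lt_top (𝒢 := 𝒢) hT hX] with ω ⟨C, hC⟩ h2 t
    exact exists_tendsto_of_liminf_upcrossings_lt_top hC h2 t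
  -- The exceptional set is Q-null, hence P-null, and completeness puts it into every 𝒢 t; modifying
  -- the paths there preserves adaptedness.
  have hGm : ∀ t, MeasurableSet[𝒢 t] G := fun t => by
    have := h𝒢.complete t Gᶜ (hPQ hGae)
    exact (@MeasurableSet.compl_iff _ _ (𝒢 t)).1 this
  have hlim : ∀ ω ∈ G, ∀ t, ∃ l, Tendsto (fun n => N (gridAfter hT n t) ω) atTop (𝓝 l) := by
    intro ω hω t
    by_cases ht : (t : ℝ) < T
    · obtain ⟨l, hl⟩ := (hω t).1
      exact ⟨l, hl.comp (tendsto_nhdsWithin_iff.2 ⟨tendsto_gridAfter hT t,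
        Eventually.of_forall fun n => ⟨lt_gridAfter hT n ht, gridAfter_mem_gridPoints hT n t⟩⟩)⟩
    · exact ⟨N t ω, by simp [gridAfter_eq_self hT _ ht]⟩
  set M : Time T → Ω → ℝ := fun t ω =>
    if ω ∈ G then limUnder atTop (fun n => N (gridAfter hT n t) ω) else 0 with hM
  have hMlim : ∀ ω ∈ G, ∀ t, Tendsto (fun n => N (gridAfter hT n t) ω) atTop (𝓝 (M t ω)) := by
    intro ω hω t
    simp only [hM, if_pos hω]
    exact tendsto_nhds_limUnder (hlim ω hω t)
  have hMs : ∀ t s : Time T, (∀ᶠ n in atTop, gridAfter hT n t ≤ s) → Measurable[𝒢 s] (M t) := by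
    intro t s hts
    obtain ⟨n₀, hn₀⟩ := eventually_atTop.1 hts
    refine @measurable_of_tendsto_metrizable Ω ℝ (𝒢 s) _ _ _ _
      (fun n => G.indicator (N (gridAfter hT (n + n₀) t))) _ (fun n => ?_) ?_
    · have h1 : Measurable[𝒢 s] (N (gridAfter hT (n + n₀) t)) :=
        (stronglyMeasurable_condExp.mono (𝒢.mono (hn₀ _ (by omega)))).measurable
      exact Measurable.indicator h1 (hGm s)
    · refine tendsto_pi_nhds.2 fun ω => ?_
      by_cases hω : ω ∈ G
      · simp only [indicator_of_mem hω]
        exact (hMlim ω hω t).comp (tendsto_add_atTop_nat n₀)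
      · simp [hM, hω]
  have hMadapted : Adapted 𝒢 M := by
    intro t
    by_cases ht : (t : ℝ) < T
    · have hlt : t < terminalTime hT := ht
      have hmax : ¬ IsMax t := fun h => h.not_lt hlt
      have := h𝒢.rightContinuous
      -- The right limit at t is measurable for every 𝒢 s with s > t; right-continuity of the
      -- filtration brings it down to 𝒢 t.
      have hEq : 𝒢 t = ⨅ s > t, 𝒢 s := by
        rw [← Filtration.rightCont_eq_of_not_isMax 𝒢 hmax, Filtration.IsRightContinuous.eq]
      rw [hEq]
      refine measurable_iff_comap_le.2 (le_iInf₂ fun s hs => measurable_iff_comap_le.1 ?_)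
      exact hMs t s (((tendsto_gridAfter hT t).eventually (Iio_mem_nhds hs)).mono
        fun n hn => le_of_lt hn)
    · exact hMs t t (Eventually.of_forall fun n => (gridAfter_eq_self hT n ht).le)
  refine ⟨M, ⟨hMadapted, fun ω => ?_⟩, fun t => ?_⟩
  · by_cases hω : ω ∈ G
    · exact isCadlagPath_of_tendsto_gridAfter (hMlim ω hω) (fun t => (hω t).1) fun t => (hω t).2
    · have : (fun t => M t ω) = fun _ => 0 := by ext t; simp [hM, hω]
      rw [this]
      exact fun t => ⟨continuousWithinAt_const, 0, tendsto_const_nhds⟩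
  · have hUI : UniformIntegrable (fun n => N (gridAfter hT n t)) 1 Q :=
      hX.uniformIntegrable_condExp fun n => 𝒢.le (gridAfter hT n t)
    have hae : ∀ᵐ ω ∂Q, Tendsto (fun n => N (gridAfter hT n t) ω) atTop (𝓝 (M t ω)) :=
      hGae.mono fun ω hω => hMlim ω hω t
    have hMi : Integrable (M t) Q := hUI.integrable_of_ae_tendsto hae
    have hL1 := tendsto_Lp_finite_of_tendsto_ae (μ := Q) le_rfl ENNReal.one_ne_top
      (fun n => (hUI.memLp n).1) (memLp_one_iff_integrable.2 hMi) hUI.unifIntegrable hae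
    -- By the tower property the error is a conditional expectation of M t - N at the next grid
    -- point. That difference tends to 0 in L¹ by uniform integrability, and the left-hand side does
    -- not depend on n.
    have hdiff : ∀ n, M t - Q[X | 𝒢 t] =ᵐ[Q] Q[M t - N (gridAfter hT n t) | 𝒢 t] := by
      intro n
      have h1 := condExp_sub (m := 𝒢 t) hMi (integrable_condExp (μ := Q) (f := X)
        (m := 𝒢 (gridAfter hT n t)))
      have h2 : Q[M t | 𝒢 t] = M t :=
        condExp_of_stronglyMeasurable (𝒢.le t) (hMadapted t).stronglyMeasurable hMi
      have h3 : Q[N (gridAfter hT n t) | 𝒢 t] =ᵐ[Q] Q[X | 𝒢 t] :=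
        condExp_condExp_of_le (𝒢.mono (le_gridAfter hT n t)) (𝒢.le _)
      rw [h2] at h1
      filter_upwards [h1, h3] with ω h1 h3
      simp only [hN, Pi.sub_apply] at h1 h3 ⊢
      rw [h1, h3]
    have hzero : eLpNorm (M t - Q[X | 𝒢 t]) 1 Q = 0 := by
      refine le_antisymm (ge_of_tendsto' hL1 fun n => ?_) zero_le
      rw [eLpNorm_congr_ae (hdiff n), eLpNorm_sub_comm]
      exact eLpNorm_condExp_le_eLpNorm _ le_rfl
    rw [eLpNorm_eq_zero_iff (hMi.1.sub integrable_condExp.1) one_ne_zero] at hzero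
    exact sub_ae_eq_zero _ _ |>.1 hzero

end CadlagVersion

/-! ### Integrability under measures of finite entropy, and completing the square -/

section Duality

variable {Ω : Type*} [mΩ : MeasurableSpace Ω] {T : ℝ} {τ : Measure (Time T)} {P Q : Measure Ω}
  {𝒢 : Filtration (Time T) mΩ} {α Λ κ : ℝ} {c : Ω → ℝ} {D : Time T → Ω → ℝ}

theorem integral_sq_nonneg {Ω : Type*} (f : Time T → Ω → ℝ) (ω : Ω) : 0 ≤ ∫ t, f t ω ^ 2 ∂τ :=
  integral_nonneg fun _ => sq_nonneg _

variable [IsFiniteMeasure τ]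

theorem memLp_uncurry_of_integrable [SFinite Q] {f : Time T → Ω → ℝ}
    (hf : Measurable (Function.uncurry f)) (h1 : ∀ᵐ ω ∂Q, MemLp (fun t => f t ω) 2 τ)
    (h2 : Integrable (fun ω => ∫ t, f t ω ^ 2 ∂τ) Q) :
    MemLp (Function.uncurry f) 2 (τ.prod Q) := by
  rw [memLp_two_iff_integrable_sq hf.aestronglyMeasurable,
    integrable_prod_iff' (hf.pow_const 2).aestronglyMeasurable]
  refine ⟨h1.mono fun ω h => h.integrable_sq, ?_⟩
  simpa [Function.uncurry] using h2

theorem ae_memLp_of_memLp_uncurry [SFinite Q] {f : Time T → Ω → ℝ}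
    (hf : Measurable (Function.uncurry f)) (h : MemLp (Function.uncurry f) 2 (τ.prod Q)) :
    ∀ᵐ ω ∂Q, MemLp (fun t => f t ω) 2 τ := by
  have h1 := h.integrable_sq
  rw [integrable_prod_iff' (hf.pow_const 2).aestronglyMeasurable] at h1
  filter_upwards [h1.1] with ω hω
  exact (memLp_two_iff_integrable_sq
    (hf.comp measurable_prodMk_right).aestronglyMeasurable).2 hω

theorem measurable_integral_sq {f : Time T → Ω → ℝ} (hf : Measurable (Function.uncurry f)) :
    Measurable fun ω => ∫ t, f t ω ^ 2 ∂τ :=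
  measurable_integral_left (f := fun t ω => f t ω ^ 2) (hf.pow_const 2)

theorem integrable_exp_gain (hT : 0 < T) (hc : Measurable c)
    (hD : Measurable (Function.uncurry D)) {φ : Time T → Ω → ℝ} (hφ : φ ∈ strategies τ P 𝒢)
    (hJ : disutility τ P α Λ c D φ ≠ ∞) :
    Integrable (fun ω => Real.exp (-α * gain τ Λ c D φ ω)) P := by
  refine ⟨((measurable_gain hc hD (hφ.1.measurable hT)).const_mul _).exp.aestronglyMeasurable, ?_⟩
  rw [hasFiniteIntegral_iff_ofReal (ae_of_all _ fun ω => (Real.exp_pos _).le)]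
  exact lt_top_iff_ne_top.2 hJ

theorem ofReal_integral_exp_gain (hT : 0 < T) (hc : Measurable c)
    (hD : Measurable (Function.uncurry D)) {φ : Time T → Ω → ℝ} (hφ : φ ∈ strategies τ P 𝒢)
    (hJ : disutility τ P α Λ c D φ ≠ ∞) :
    ENNReal.ofReal (∫ ω, Real.exp (-α * gain τ Λ c D φ ω) ∂P) = disutility τ P α Λ c D φ :=
  ofReal_integral_eq_lintegral_ofReal (integrable_exp_gain hT hc hD hφ hJ)
    (ae_of_all _ fun _ => (Real.exp_pos _).le)

/-- For bounded φ the terms in c and D are linear, and completing squares absorbs them into κ(c² + ∫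
D²) at the cost of a constant. No smallness of α relative to κ is needed. -/
theorem disutility_ne_top_of_abs_le (hT : 0 < T) (hα : 0 < α) (hΛ : 0 < Λ) (hκ : 0 < κ)
    (hD2 : ∀ ω, MemLp (fun t => D t ω) 2 τ)
    (hexp : Integrable (fun ω => Real.exp (κ * (c ω ^ 2 + ∫ t, D t ω ^ 2 ∂τ))) P)
    {φ : Time T → Ω → ℝ} (hφ : IsOptional 𝒢 φ) {C : ℝ} (hC : ∀ t ω, |φ t ω| ≤ C) :
    disutility τ P α Λ c D φ ≠ ∞ := by
  have hφm := hφ.measurable hT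
  set K : ℝ := α ^ 2 / (4 * κ) + (α ^ 2 * C ^ 2 / (4 * κ) + α * (Λ / 2) * C ^ 2) * τ.real univ with hK
  have hb : ∀ ω, -α * gain τ Λ c D φ ω ≤ κ * (c ω ^ 2 + ∫ t, D t ω ^ 2 ∂τ) + K := by
    intro ω
    have hφω : MemLp (fun t => φ t ω) 2 τ :=
      (memLp_top_of_bound (hφm.comp measurable_prodMk_right).aestronglyMeasurable C
        (ae_of_all _ fun t => hC t ω)).mono_exponent le_top
    have hDφ := integrable_mul_of_memLp_two (hD2 ω) hφω
    have hI : -α * (∫ t, D t ω * φ t ω ∂τ) + α * (Λ / 2) * (∫ t, φ t ω ^ 2 ∂τ)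
        ≤ κ * (∫ t, D t ω ^ 2 ∂τ)
          + (α ^ 2 * C ^ 2 / (4 * κ) + α * (Λ / 2) * C ^ 2) * τ.real univ := by
      have e : (α ^ 2 * C ^ 2 / (4 * κ) + α * (Λ / 2) * C ^ 2) * τ.real univ
          = ∫ _, (α ^ 2 * C ^ 2 / (4 * κ) + α * (Λ / 2) * C ^ 2) ∂τ := by
        rw [integral_const, smul_eq_mul, mul_comm]
      rw [e, ← integral_const_mul, ← integral_const_mul, ← integral_const_mul,
        ← integral_add (hDφ.const_mul _) (hφω.integrable_sq.const_mul _),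
        ← integral_add ((hD2 ω).integrable_sq.const_mul _) (integrable_const _)]
      refine integral_mono ((hDφ.const_mul _).add (hφω.integrable_sq.const_mul _))
        (((hD2 ω).integrable_sq.const_mul _).add (integrable_const _)) fun t => ?_
      have hsq : φ t ω ^ 2 ≤ C ^ 2 := sq_le_sq' (neg_le_of_abs_le (hC t ω)) (le_of_abs_le (hC t ω))
      have h1 : α * (Λ / 2) * φ t ω ^ 2 ≤ α * (Λ / 2) * C ^ 2 := by gcongr
      have h2 : -α * (D t ω * φ t ω) ≤ κ * D t ω ^ 2 + α ^ 2 * φ t ω ^ 2 / (4 * κ) := by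
        have : κ * D t ω ^ 2 + α ^ 2 * φ t ω ^ 2 / (4 * κ) - -α * (D t ω * φ t ω)
            = κ * (D t ω + α * φ t ω / (2 * κ)) ^ 2 := by field_simp; ring
        have h3 : 0 ≤ κ * (D t ω + α * φ t ω / (2 * κ)) ^ 2 := by positivity
        linarith
      have h3 : α ^ 2 * φ t ω ^ 2 / (4 * κ) ≤ α ^ 2 * C ^ 2 / (4 * κ) := by gcongr
      simp only
      linarith
    have hc' : -α * c ω ≤ κ * c ω ^ 2 + α ^ 2 / (4 * κ) := by
      have : κ * c ω ^ 2 + α ^ 2 / (4 * κ) - -α * c ω = κ * (c ω + α / (2 * κ)) ^ 2 := by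
        field_simp; ring
      have h3 : 0 ≤ κ * (c ω + α / (2 * κ)) ^ 2 := by positivity
      linarith
    simp only [gain, quad, hK]
    linarith
  have hint : Integrable (fun ω => Real.exp (κ * (c ω ^ 2 + ∫ t, D t ω ^ 2 ∂τ) + K)) P := by
    simp only [Real.exp_add]
    exact hexp.mul_const _
  refine ne_top_of_le_ne_top hint.lintegral_lt_top.ne (lintegral_mono fun ω => ?_)
  exact ENNReal.ofReal_le_ofReal (Real.exp_le_exp.2 (hb ω))

section Integrability

variable [IsProbabilityMeasure P]

theorem integrable_sq_add_of_exp (hκ : 0 < κ) (hc : Measurable c)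
    (hD : Measurable (Function.uncurry D))
    (hexp : Integrable (fun ω => Real.exp (κ * (c ω ^ 2 + ∫ t, D t ω ^ 2 ∂τ))) P)
    (hQ : Q ∈ finiteEntropy P) : Integrable c Q ∧ Integrable (fun ω => ∫ t, D t ω ^ 2 ∂τ) Q := by
  have := hQ.1
  have hm := measurable_integral_sq (τ := τ) hD
  have hR : Integrable (fun ω => κ * (c ω ^ 2 + ∫ t, D t ω ^ 2 ∂τ)) Q :=
    integrable_of_integrable_exp hQ (by fun_prop)
      (fun ω => mul_nonneg hκ.le (add_nonneg (sq_nonneg _) (integral_sq_nonneg D ω))) hexp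
  have hR' : Integrable (fun ω => c ω ^ 2 + ∫ t, D t ω ^ 2 ∂τ) Q :=
    (hR.const_mul κ⁻¹).congr (ae_of_all _ fun ω => by field_simp)
  refine ⟨((integrable_const (1 : ℝ)).add hR').mono' hc.aestronglyMeasurable
    (ae_of_all _ fun ω => ?_), hR'.mono' hm.aestronglyMeasurable (ae_of_all _ fun ω => ?_)⟩
  · have := integral_sq_nonneg (τ := τ) D ω
    simp only [Pi.add_apply, Real.norm_eq_abs]
    exact abs_le.2 ⟨by nlinarith [sq_nonneg (c ω + 1)], by nlinarith [sq_nonneg (c ω - 1)]⟩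
  · rw [Real.norm_of_nonneg (integral_sq_nonneg D ω)]
    linarith [sq_nonneg (c ω)]

/-- Finite disutility gives αV⁻ an exponential moment, so V⁻ is Q-integrable, while V⁺ is controlled
by c and ∫ D². The spare (Λ/4) ∫ φ² in `quad_add_le` then bounds the L² norm of φ. -/
theorem integrable_gain_and_memLp (hT : 0 < T) (hα : 0 < α) (hΛ : 0 < Λ) (hκ : 0 < κ)
    (hc : Measurable c) (hD : Measurable (Function.uncurry D))
    (hD2 : ∀ ω, MemLp (fun t => D t ω) 2 τ)
    (hexp : Integrable (fun ω => Real.exp (κ * (c ω ^ 2 + ∫ t, D t ω ^ 2 ∂τ))) P)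
    (hQ : Q ∈ finiteEntropy P) {φ : Time T → Ω → ℝ} (hφ : φ ∈ strategies τ P 𝒢)
    (hJ : disutility τ P α Λ c D φ ≠ ∞) :
    Integrable (gain τ Λ c D φ) Q ∧ MemLp (Function.uncurry φ) 2 (τ.prod Q) := by
  have := hQ.1
  have hφm := hφ.1.measurable hT
  obtain ⟨hcQ, hDQ⟩ := integrable_sq_add_of_exp hκ hc hD hexp hQ
  have hVm : Measurable (gain τ Λ c D φ) := measurable_gain hc hD hφm
  have hneg : Integrable (fun ω => α * max (-gain τ Λ c D φ ω) 0) Q := by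
    refine integrable_of_integrable_exp hQ (by fun_prop)
      (fun ω => mul_nonneg hα.le (le_max_right _ _)) ?_
    refine ((integrable_exp_gain hT hc hD hφ hJ).add (integrable_const 1)).mono' (by fun_prop)
      (ae_of_all _ fun ω => ?_)
    rw [Real.norm_of_nonneg (Real.exp_pos _).le]
    simp only [Pi.add_apply]
    rcases le_total (-gain τ Λ c D φ ω) 0 with h | h
    · rw [max_eq_right h, mul_zero, Real.exp_zero]
      linarith [Real.exp_pos (-α * gain τ Λ c D φ ω)]
    · rw [max_eq_left h]
      have : α * -gain τ Λ c D φ ω = -α * gain τ Λ c D φ ω := by ring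
      rw [this]; linarith
  have hneg' : Integrable (fun ω => max (-gain τ Λ c D φ ω) 0) Q :=
    (hneg.const_mul α⁻¹).congr (ae_of_all _ fun ω => by field_simp)
  have hmem : ∀ᵐ ω ∂Q, MemLp (fun t => φ t ω) 2 τ := hQ.2.1.ae_le hφ.2
  have hle : ∀ᵐ ω ∂Q, gain τ Λ c D φ ω + Λ / 4 * ∫ t, φ t ω ^ 2 ∂τ
      ≤ c ω + 1 / Λ * ∫ t, D t ω ^ 2 ∂τ := hmem.mono fun ω h => quad_add_le hΛ (hD2 ω) h
  have hVi : Integrable (gain τ Λ c D φ) Q := by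
    refine ((hcQ.abs.add (hDQ.const_mul (1 / Λ))).add hneg').mono' hVm.aestronglyMeasurable ?_
    filter_upwards [hle] with ω h
    have h1 : 0 ≤ Λ / 4 * ∫ t, φ t ω ^ 2 ∂τ := mul_nonneg (by positivity) (integral_sq_nonneg φ ω)
    have h2 : 0 ≤ 1 / Λ * ∫ t, D t ω ^ 2 ∂τ := mul_nonneg (by positivity) (integral_sq_nonneg D ω)
    have h3 := le_abs_self (c ω)
    have h4 := le_max_left (-gain τ Λ c D φ ω) 0
    have h5 := le_max_right (-gain τ Λ c D φ ω) 0
    have h6 := abs_nonneg (c ω)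
    simp only [Pi.add_apply, Real.norm_eq_abs]
    exact abs_le.2 ⟨by linarith, by linarith⟩
  refine ⟨hVi, memLp_uncurry_of_integrable hφm hmem ?_⟩
  have hsq := (((hcQ.abs.add (hDQ.const_mul (1 / Λ))).add hVi.abs).const_mul (4 / Λ))
  refine hsq.mono' (measurable_integral_sq hφm).aestronglyMeasurable ?_
  filter_upwards [hle] with ω h
  rw [Real.norm_of_nonneg (integral_sq_nonneg φ ω)]
  simp only [Pi.add_apply]
  have h3 := le_abs_self (c ω)
  have h4 := neg_abs_le (gain τ Λ c D φ ω)
  calc ∫ t, φ t ω ^ 2 ∂τ = 4 / Λ * (Λ / 4 * ∫ t, φ t ω ^ 2 ∂τ) := by field_simp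
    _ ≤ _ := by
      apply mul_le_mul_of_nonneg_left _ (by positivity)
      linarith

end Integrability

theorem integral_gain [IsProbabilityMeasure Q] (hcQ : Integrable c Q)
    (hD : MemLp (Function.uncurry D) 2 (τ.prod Q)) {φ g : Time T → Ω → ℝ}
    (hφ : MemLp (Function.uncurry φ) 2 (τ.prod Q)) (hg : MemLp (Function.uncurry g) 2 (τ.prod Q))
    (horth : ∫ p, D p.1 p.2 * φ p.1 p.2 ∂(τ.prod Q) = Λ * ∫ p, g p.1 p.2 * φ p.1 p.2 ∂(τ.prod Q)) :
    ∫ ω, gain τ Λ c D φ ω ∂Q = (∫ ω, c ω ∂Q) + Λ / 2 * (∫ p, g p.1 p.2 ^ 2 ∂(τ.prod Q))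
      - Λ / 2 * ∫ p, (φ p.1 p.2 - g p.1 p.2) ^ 2 ∂(τ.prod Q) := by
  have hDφ : Integrable (fun p : Time T × Ω => D p.1 p.2 * φ p.1 p.2) (τ.prod Q) :=
    hD.integrable_mul hφ
  have hgφ : Integrable (fun p : Time T × Ω => g p.1 p.2 * φ p.1 p.2) (τ.prod Q) :=
    hg.integrable_mul hφ
  have hφφ : Integrable (fun p : Time T × Ω => φ p.1 p.2 ^ 2) (τ.prod Q) := hφ.integrable_sq
  have hgg : Integrable (fun p : Time T × Ω => g p.1 p.2 ^ 2) (τ.prod Q) := hg.integrable_sq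
  have hadd : Integrable (fun ω => c ω + ∫ t, D t ω * φ t ω ∂τ) Q :=
    hcQ.add hDφ.integral_prod_right
  have e1 : ∫ ω, gain τ Λ c D φ ω ∂Q = (∫ ω, c ω ∂Q) + (∫ p, D p.1 p.2 * φ p.1 p.2 ∂(τ.prod Q))
      - Λ / 2 * ∫ p, φ p.1 p.2 ^ 2 ∂(τ.prod Q) := by
    rw [integral_prod_symm _ hDφ, integral_prod_symm _ hφφ, ← integral_const_mul,
      ← integral_add hcQ hDφ.integral_prod_right,
      ← integral_sub hadd (hφφ.integral_prod_right.const_mul _)]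
    rfl
  have e2 : ∫ p, (φ p.1 p.2 - g p.1 p.2) ^ 2 ∂(τ.prod Q) = (∫ p, φ p.1 p.2 ^ 2 ∂(τ.prod Q))
      - 2 * (∫ p, g p.1 p.2 * φ p.1 p.2 ∂(τ.prod Q)) + ∫ p, g p.1 p.2 ^ 2 ∂(τ.prod Q) := by
    have hI : Integrable (fun p : Time T × Ω => φ p.1 p.2 ^ 2 - 2 * (g p.1 p.2 * φ p.1 p.2))
      (τ.prod Q) := hφφ.sub (hgφ.const_mul 2)
    rw [← integral_const_mul, ← integral_sub hφφ (hgφ.const_mul _), ← integral_add hI hgg]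
    congr 1; ext p; ring
  rw [e1, e2, horth]
  ring

end Duality

/-! ### Weak and strong duality for a general quadratic gain -/

section StrongDuality

variable {Ω : Type*} [mΩ : MeasurableSpace Ω] {T : ℝ} {τ : Measure (Time T)} [IsFiniteMeasure τ]
  {P Q : Measure Ω} [IsProbabilityMeasure P] {𝒢 : Filtration (Time T) mΩ} {α Λ κ : ℝ} {c : Ω → ℝ}
  {D : Time T → Ω → ℝ} {g : Time T → Ω → ℝ}

/-- The optional process `g` represents the functional `φ ↦ Λ⁻¹ E_Q ∫ D φ dτ` on the optional
processes in `L²(τ ⊗ Q)`. -/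
structure IsOptionalProjection (τ : Measure (Time T)) (Q : Measure Ω) (𝒢 : Filtration (Time T) mΩ)
    (Λ : ℝ) (D g : Time T → Ω → ℝ) : Prop where
  isOptional : IsOptional 𝒢 g
  memLp : MemLp (Function.uncurry g) 2 (τ.prod Q)
  integral_eq : ∀ φ : Time T → Ω → ℝ, IsOptional 𝒢 φ → MemLp (Function.uncurry φ) 2 (τ.prod Q) →
    ∫ p, D p.1 p.2 * φ p.1 p.2 ∂(τ.prod Q) = Λ * ∫ p, g p.1 p.2 * φ p.1 p.2 ∂(τ.prod Q)

/-- The dual functional, expressed through the optional process `g` induced by `Q`. -/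
noncomputable def dualValue (τ : Measure (Time T)) (P : Measure Ω) (α Λ : ℝ) (c : Ω → ℝ)
    (g : Time T → Ω → ℝ) (Q : Measure Ω) : ℝ :=
  (∫ ω, c ω ∂Q) + 1 / α * (∫ ω, llr Q P ω ∂Q) + Λ / 2 * ∫ p, g p.1 p.2 ^ 2 ∂(τ.prod Q)

theorem memLp_uncurry_of_finiteEntropy (hκ : 0 < κ) (hc : Measurable c)
    (hD : Measurable (Function.uncurry D)) (hD2 : ∀ ω, MemLp (fun t => D t ω) 2 τ)
    (hexp : Integrable (fun ω => Real.exp (κ * (c ω ^ 2 + ∫ t, D t ω ^ 2 ∂τ))) P)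
    (hQ : Q ∈ finiteEntropy P) : MemLp (Function.uncurry D) 2 (τ.prod Q) :=
  have := hQ.1
  memLp_uncurry_of_integrable hD (ae_of_all _ hD2) (integrable_sq_add_of_exp hκ hc hD hexp hQ).2

/-- Weak duality, with the case of equality. -/
theorem log_disutility_le_dualValue (hT : 0 < T) (hα : 0 < α) (hΛ : 0 < Λ) (hκ : 0 < κ)
    (hc : Measurable c) (hD : Measurable (Function.uncurry D))
    (hD2 : ∀ ω, MemLp (fun t => D t ω) 2 τ)
    (hexp : Integrable (fun ω => Real.exp (κ * (c ω ^ 2 + ∫ t, D t ω ^ 2 ∂τ))) P)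
    (hQ : Q ∈ finiteEntropy P) (hg : IsOptionalProjection τ Q 𝒢 Λ D g) {φ : Time T → Ω → ℝ}
    (hφ : φ ∈ strategies τ P 𝒢) (hJ : disutility τ P α Λ c D φ ≠ ∞) :
    -(1 / α) * Real.log (∫ ω, Real.exp (-α * gain τ Λ c D φ ω) ∂P) ≤ dualValue τ P α Λ c g Q ∧
      (dualValue τ P α Λ c g Q
          ≤ -(1 / α) * Real.log (∫ ω, Real.exp (-α * gain τ Λ c D φ ω) ∂P) →
        Q = P.tilted fun ω => -α * gain τ Λ c D φ ω) := by
  have := hQ.1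
  obtain ⟨hVi, hφ2⟩ := integrable_gain_and_memLp hT hα hΛ hκ hc hD hD2 hexp hQ hφ hJ
  have hcQ := (integrable_sq_add_of_exp hκ hc hD hexp hQ).1
  have hE := integral_gain hcQ (memLp_uncurry_of_finiteEntropy hκ hc hD hD2 hexp hQ) hφ2 hg.memLp
    (hg.integral_eq φ hφ.1 hφ2)
  have hsq : 0 ≤ Λ / 2 * ∫ p, (φ p.1 p.2 - g p.1 p.2) ^ 2 ∂(τ.prod Q) :=
    mul_nonneg (by positivity) (integral_nonneg fun _ => sq_nonneg _)
  have hi := integrable_exp_gain hT hc hD hφ hJ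
  have hgibbs := integral_le_of_finiteEntropy hQ (hVi.const_mul (-α)) hi
  rw [integral_const_mul] at hgibbs
  have h1 : -(1 / α) * Real.log (∫ ω, Real.exp (-α * gain τ Λ c D φ ω) ∂P)
      ≤ ∫ ω, gain τ Λ c D φ ω ∂Q + 1 / α * ∫ ω, llr Q P ω ∂Q := by
    have h := mul_le_mul_of_nonneg_left hgibbs (one_div_pos.2 hα).le
    have e : 1 / α * (-α * ∫ ω, gain τ Λ c D φ ω ∂Q) = -∫ ω, gain τ Λ c D φ ω ∂Q := by
      field_simp
    rw [e] at h
    linarith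
  have h2 : ∫ ω, gain τ Λ c D φ ω ∂Q + 1 / α * ∫ ω, llr Q P ω ∂Q ≤ dualValue τ P α Λ c g Q := by
    rw [hE, dualValue]; linarith
  refine ⟨h1.trans h2, fun h => eq_tilted_of_integral_eq hQ (hVi.const_mul (-α)) hi ?_⟩
  rw [integral_const_mul]
  have h3 := mul_le_mul_of_nonneg_left (h2.trans h) hα.le
  have e1 : α * (∫ ω, gain τ Λ c D φ ω ∂Q + 1 / α * ∫ ω, llr Q P ω ∂Q)
      = α * (∫ ω, gain τ Λ c D φ ω ∂Q) + ∫ ω, llr Q P ω ∂Q := by field_simp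
  have e2 : α * (-(1 / α) * Real.log (∫ ω, Real.exp (-α * gain τ Λ c D φ ω) ∂P))
      = -Real.log (∫ ω, Real.exp (-α * gain τ Λ c D φ ω) ∂P) := by field_simp
  rw [e1, e2] at h3
  linarith

/-- A minimizer of the disutility has finite entropy under the measure it induces, and it
maximizes the expected gain under this measure. -/
theorem tilted_mem_finiteEntropy_of_minimal (hT : 0 < T) (hα : 0 < α) (hΛ : 0 < Λ) (hκ : 0 < κ)
    (hc : Measurable c) (hD : Measurable (Function.uncurry D))
    (hD2 : ∀ ω, MemLp (fun t => D t ω) 2 τ)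
    (hexp : Integrable (fun ω => Real.exp (κ * (c ω ^ 2 + ∫ t, D t ω ^ 2 ∂τ))) P)
    {φ : Time T → Ω → ℝ} (hφ : φ ∈ strategies τ P 𝒢) (hJ : disutility τ P α Λ c D φ ≠ ∞)
    (hmin : ∀ ψ ∈ strategies τ P 𝒢, disutility τ P α Λ c D φ ≤ disutility τ P α Λ c D ψ) :
    (P.tilted fun ω => -α * gain τ Λ c D φ ω) ∈ finiteEntropy P ∧
      ∀ ψ ∈ strategies τ P 𝒢, disutility τ P α Λ c D ψ ≠ ∞ →
        ∫ ω, gain τ Λ c D ψ ω ∂(P.tilted fun ω => -α * gain τ Λ c D φ ω)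
          ≤ ∫ ω, gain τ Λ c D φ ω ∂(P.tilted fun ω => -α * gain τ Λ c D φ ω) := by
  set b : Ω → ℝ := fun ω => -α * gain τ Λ c D φ ω with hb
  have hbm : Measurable b := (measurable_gain hc hD (hφ.1.measurable hT)).const_mul _
  have heb : Integrable (fun ω => Real.exp (b ω)) P := integrable_exp_gain hT hc hD hφ hJ
  have hfoc : ∀ ψ ∈ strategies τ P 𝒢, disutility τ P α Λ c D ψ ≠ ∞ →
      Integrable (fun ω => Real.exp (b ω) * (-α * gain τ Λ c D ψ ω - b ω)) P ∧
        0 ≤ ∫ ω, Real.exp (b ω) * (-α * gain τ Λ c D ψ ω - b ω) ∂P := by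
    intro ψ hψ hJψ
    have ham : Measurable fun ω => -α * gain τ Λ c D ψ ω :=
      (measurable_gain hc hD (hψ.1.measurable hT)).const_mul _
    have hea := integrable_exp_gain hT hc hD hψ hJψ
    refine integrable_exp_mul_sub_and_nonneg ham hbm hea heb fun s hs => ?_
    have hχ := convexComb_mem_strategies hφ hψ s
    -- Concavity puts the gain of the mixed strategy above the mixture of the gains, so minimality
    -- among strategies implies minimality along the segment of exponents.
    have hle : ∀ᵐ ω ∂P, Real.exp (-α * gain τ Λ c D (fun t ω => (1 - s) * φ t ω + s * ψ t ω) ω)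
        ≤ Real.exp ((1 - s) * b ω + s * (-α * gain τ Λ c D ψ ω)) := by
      filter_upwards [hφ.2, hψ.2] with ω h1 h2
      refine Real.exp_le_exp.2 ?_
      have h3 := quad_convexComb (Λ := Λ) (c := c ω) (hD2 ω) h1 h2 s
      have h4 : 0 ≤ α * (s * (1 - s) * (Λ / 2) * ∫ t, (φ t ω - ψ t ω) ^ 2 ∂τ) := by
        have : 0 ≤ 1 - s := sub_nonneg.2 hs.2
        have := hs.1
        exact mul_nonneg hα.le (mul_nonneg (by positivity)
          (integral_nonneg fun _ => sq_nonneg _))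
      simp only [hb, gain] at h3 ⊢
      rw [h3]
      linarith
    have hmix : Integrable (fun ω => Real.exp ((1 - s) * b ω + s * (-α * gain τ Λ c D ψ ω))) P := by
      refine ((heb.const_mul (1 - s)).add (hea.const_mul s)).mono' (by fun_prop)
        (ae_of_all _ fun ω => ?_)
      rw [Real.norm_of_nonneg (Real.exp_pos _).le]
      exact convexOn_exp.2 (mem_univ (b ω)) (mem_univ _) (sub_nonneg.2 hs.2) hs.1.le (by ring)
    rw [← ENNReal.ofReal_le_ofReal_iff (integral_nonneg fun _ => (Real.exp_pos _).le),
      ofReal_integral_exp_gain hT hc hD hφ hJ,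
      ofReal_integral_eq_lintegral_ofReal hmix (ae_of_all _ fun _ => (Real.exp_pos _).le)]
    refine (hmin _ hχ).trans (lintegral_mono_ae ?_)
    filter_upwards [hle] with ω h using ENNReal.ofReal_le_ofReal h
  have hzero : (fun _ _ => 0 : Time T → Ω → ℝ) ∈ strategies τ P 𝒢 :=
    ⟨measurable_const (α := ℝ), ae_of_all _ fun _ => MemLp.zero⟩
  have hJ0 : disutility τ P α Λ c D (fun _ _ => 0) ≠ ∞ :=
    disutility_ne_top_of_abs_le hT hα hΛ hκ hD2 hexp hzero.1 (C := 0) (by simp)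
  -- The doubled exponent demanded by `integrable_exp_mul_self` is supplied by the zero strategy at
  -- risk aversion 2α.
  have hexp2 : Integrable (fun ω => Real.exp (2 * (-α * gain τ Λ c D (fun _ _ => 0) ω))) P := by
    have h := disutility_ne_top_of_abs_le (α := 2 * α) hT (by positivity) hΛ hκ hD2 hexp hzero.1
      (C := 0) (by simp)
    refine (integrable_exp_gain hT hc hD hzero h).congr (ae_of_all _ fun ω => ?_)
    simp only
    ring_nf
  have hbb : Integrable (fun ω => Real.exp (b ω) * b ω) P :=
    integrable_exp_mul_self hbm hexp2 (hfoc _ hzero hJ0).1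
  refine ⟨tilted_mem_finiteEntropy heb hbb, fun ψ hψ hJψ => ?_⟩
  have hQ := tilted_mem_finiteEntropy heb hbb
  have h1 := (integrable_gain_and_memLp hT hα hΛ hκ hc hD hD2 hexp hQ hφ hJ).1
  have h2 := (integrable_gain_and_memLp hT hα hΛ hκ hc hD hD2 hexp hQ hψ hJψ).1
  have h3 : 0 ≤ ∫ ω, (-α * gain τ Λ c D ψ ω - b ω) ∂(P.tilted b) := by
    rw [integral_tilted]
    have e : ∀ ω, (Real.exp (b ω) / ∫ ω, Real.exp (b ω) ∂P) • (-α * gain τ Λ c D ψ ω - b ω)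
        = (∫ ω, Real.exp (b ω) ∂P)⁻¹ * (Real.exp (b ω) * (-α * gain τ Λ c D ψ ω - b ω)) := by
      intro ω; rw [smul_eq_mul]; ring
    simp only [e]
    rw [integral_const_mul]
    exact mul_nonneg (inv_nonneg.2 (integral_nonneg fun _ => (Real.exp_pos _).le))
      (hfoc ψ hψ hJψ).2
  simp only [hb] at h3
  rw [integral_sub (h2.const_mul _) (h1.const_mul _), integral_const_mul, integral_const_mul] at h3
  nlinarith

/-- By `integral_gain`, maximizing the expected gain means minimizing the L² distance to g. As g
itself is not known to have finite disutility, φ is compared with the truncations of g, which do and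
which converge to g in L². -/
theorem ae_eq_of_integral_gain_le (hT : 0 < T) (hα : 0 < α) (hΛ : 0 < Λ) (hκ : 0 < κ)
    (hc : Measurable c) (hD : Measurable (Function.uncurry D))
    (hD2 : ∀ ω, MemLp (fun t => D t ω) 2 τ)
    (hexp : Integrable (fun ω => Real.exp (κ * (c ω ^ 2 + ∫ t, D t ω ^ 2 ∂τ))) P)
    (hQ : Q ∈ finiteEntropy P) (hg : IsOptionalProjection τ Q 𝒢 Λ D g) {φ : Time T → Ω → ℝ}
    (hφ : φ ∈ strategies τ P 𝒢) (hJ : disutility τ P α Λ c D φ ≠ ∞)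
    (hmax : ∀ ψ ∈ strategies τ P 𝒢, disutility τ P α Λ c D ψ ≠ ∞ →
      ∫ ω, gain τ Λ c D ψ ω ∂Q ≤ ∫ ω, gain τ Λ c D φ ω ∂Q) :
    ∀ᵐ p ∂(τ.prod Q), φ p.1 p.2 = g p.1 p.2 := by
  have := hQ.1
  have hcQ := (integrable_sq_add_of_exp hκ hc hD hexp hQ).1
  have hDQ := memLp_uncurry_of_finiteEntropy hκ hc hD hD2 hexp hQ
  have hφ2 := (integrable_gain_and_memLp hT hα hΛ hκ hc hD hD2 hexp hQ hφ hJ).2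
  have hgm := hg.isOptional.measurable hT
  set ψ : ℕ → Time T → Ω → ℝ := fun k t ω => max (-(k : ℝ)) (min k (g t ω)) with hψ
  have hψo : ∀ k, IsOptional 𝒢 (ψ k) := fun k =>
    Measurable.max measurable_const (Measurable.min measurable_const hg.isOptional)
  have hψb : ∀ k t ω, |ψ k t ω| ≤ k := fun k t ω =>
    abs_le.2 ⟨le_max_left _ _, max_le (by linarith [k.cast_nonneg (α := ℝ)]) (min_le_left _ _)⟩
  have hψs : ∀ k, ψ k ∈ strategies τ P 𝒢 := fun k => ⟨hψo k, ae_of_all _ fun ω =>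
    (memLp_top_of_bound (((hψo k).measurable hT).comp measurable_prodMk_right).aestronglyMeasurable
      k (ae_of_all _ fun t => hψb k t ω)).mono_exponent le_top⟩
  have hψ2 : ∀ k, MemLp (Function.uncurry (ψ k)) 2 (τ.prod Q) := fun k =>
    (memLp_top_of_bound ((hψo k).measurable hT).aestronglyMeasurable
      k (ae_of_all _ fun p => hψb k p.1 p.2)).mono_exponent le_top
  have hle : ∀ k, ∫ p, (φ p.1 p.2 - g p.1 p.2) ^ 2 ∂(τ.prod Q)
      ≤ ∫ p, (ψ k p.1 p.2 - g p.1 p.2) ^ 2 ∂(τ.prod Q) := by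
    intro k
    have h := hmax _ (hψs k) (disutility_ne_top_of_abs_le hT hα hΛ hκ hD2 hexp (hψo k) (hψb k))
    rw [integral_gain hcQ hDQ hφ2 hg.memLp (hg.integral_eq φ hφ.1 hφ2),
      integral_gain hcQ hDQ (hψ2 k) hg.memLp (hg.integral_eq _ (hψo k) (hψ2 k))] at h
    have : 0 < Λ / 2 := by positivity
    nlinarith
  have hlim : Tendsto (fun k => ∫ p, (ψ k p.1 p.2 - g p.1 p.2) ^ 2 ∂(τ.prod Q)) atTop (𝓝 0) := by
    have h := tendsto_integral_of_dominated_convergence (μ := τ.prod Q)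
      (F := fun k p => (ψ k p.1 p.2 - g p.1 p.2) ^ 2) (f := fun _ => 0)
      (fun p => g p.1 p.2 ^ 2) (fun k => ?_) hg.memLp.integrable_sq (fun k => ?_) ?_
    · simpa using h
    · exact ((((hψo k).measurable hT).sub hgm).pow_const 2).aestronglyMeasurable
    · refine ae_of_all _ fun p => ?_
      rw [Real.norm_of_nonneg (sq_nonneg _)]
      refine sq_le_sq.2 (abs_le.2 ?_)
      have hk := k.cast_nonneg (α := ℝ)
      have h0 := neg_abs_le (g p.1 p.2)
      have h1 := le_abs_self (g p.1 p.2)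
      have h2 := abs_nonneg (g p.1 p.2)
      simp only [hψ]
      rcases max_cases (-(k : ℝ)) (min k (g p.1 p.2)) with ⟨h, h'⟩ | ⟨h, h'⟩ <;>
      rcases min_cases (k : ℝ) (g p.1 p.2) with ⟨h3, h4⟩ | ⟨h3, h4⟩ <;>
      rw [h] <;> (try rw [h3]) <;> constructor <;> linarith
    · refine ae_of_all _ fun p => ?_
      refine tendsto_const_nhds.congr' ?_
      obtain ⟨K, hK⟩ := exists_nat_ge |g p.1 p.2|
      filter_upwards [eventually_ge_atTop K] with k hk
      have hk' : |g p.1 p.2| ≤ k := hK.trans (by exact_mod_cast hk)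
      simp only [hψ]
      rw [min_eq_right (abs_le.1 hk').2, max_eq_right (abs_le.1 hk').1]
      simp
  have hint : Integrable (fun p : Time T × Ω => (φ p.1 p.2 - g p.1 p.2) ^ 2) (τ.prod Q) :=
    (hφ2.sub hg.memLp).integrable_sq
  have h0 : ∫ p, (φ p.1 p.2 - g p.1 p.2) ^ 2 ∂(τ.prod Q) = 0 :=
    le_antisymm (ge_of_tendsto' hlim hle) (integral_nonneg fun _ => sq_nonneg _)
  rw [integral_eq_zero_iff_of_nonneg (fun _ => sq_nonneg _) hint] at h0
  filter_upwards [h0] with p hp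
  simpa [sub_eq_zero] using hp

theorem gain_ae_eq_of_ae_eq (hT : 0 < T) {φ ψ : Time T → Ω → ℝ} (hφ : IsOptional 𝒢 φ)
    (hψ : IsOptional 𝒢 ψ) (h : ∀ᵐ p ∂(τ.prod P), φ p.1 p.2 = ψ p.1 p.2) :
    (∀ᵐ ω ∂P, (fun t => φ t ω) =ᵐ[τ] fun t => ψ t ω) ∧
      disutility τ P α Λ c D φ = disutility τ P α Λ c D ψ := by
  have hset : MeasurableSet {p : Time T × Ω | φ p.1 p.2 = ψ p.1 p.2} :=
    measurableSet_eq_fun (hφ.measurable hT) (hψ.measurable hT)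
  have h1 := (Measure.ae_ae_comm (p := fun t ω => φ t ω = ψ t ω) hset).1
    ((Measure.ae_prod_mem_iff_ae_ae_mem hset).1 h)
  refine ⟨h1, lintegral_congr_ae ?_⟩
  filter_upwards [h1] with ω hω
  have e1 : ∫ t, D t ω * φ t ω ∂τ = ∫ t, D t ω * ψ t ω ∂τ :=
    integral_congr_ae (hω.mono fun t ht => by simp only [ht])
  have e2 : ∫ t, φ t ω ^ 2 ∂τ = ∫ t, ψ t ω ^ 2 ∂τ :=
    integral_congr_ae (hω.mono fun t ht => by simp only [ht])
  simp only [gain, quad, e1, e2]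

/-- Strong duality: a measure `Q'` of finite entropy whose induced process is an optimal strategy
and which is the unique minimizer of the dual functional. -/
theorem exists_dual_minimizer (hT : 0 < T) (hα : 0 < α) (hΛ : 0 < Λ) (hκ : 0 < κ)
    (hc : Measurable c) (hD : Measurable (Function.uncurry D))
    (hD2 : ∀ ω, MemLp (fun t => D t ω) 2 τ)
    (hexp : Integrable (fun ω => Real.exp (κ * (c ω ^ 2 + ∫ t, D t ω ^ 2 ∂τ))) P)
    {G : Measure Ω → Time T → Ω → ℝ}
    (hG : ∀ Q ∈ finiteEntropy P, IsOptionalProjection τ Q 𝒢 Λ D (G Q)) :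
    ∃ Q' ∈ finiteEntropy P, G Q' ∈ strategies τ P 𝒢 ∧ disutility τ P α Λ c D (G Q') ≠ ∞ ∧
      (∀ ψ ∈ strategies τ P 𝒢, disutility τ P α Λ c D (G Q') ≤ disutility τ P α Λ c D ψ) ∧
      -(1 / α) * Real.log (∫ ω, Real.exp (-α * gain τ Λ c D (G Q') ω) ∂P)
        = dualValue τ P α Λ c (G Q') Q' ∧
      ∀ Q ∈ finiteEntropy P, dualValue τ P α Λ c (G Q') Q' ≤ dualValue τ P α Λ c (G Q) Q ∧
        (dualValue τ P α Λ c (G Q) Q ≤ dualValue τ P α Λ c (G Q') Q' → Q = Q') := by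
  have hzero : (fun _ _ => 0 : Time T → Ω → ℝ) ∈ strategies τ P 𝒢 :=
    ⟨measurable_const (α := ℝ), ae_of_all _ fun _ => MemLp.zero⟩
  have hJ0 : disutility τ P α Λ c D (fun _ _ => 0) ≠ ∞ :=
    disutility_ne_top_of_abs_le hT hα hΛ hκ hD2 hexp hzero.1 (C := 0) (by simp)
  obtain ⟨φ, hφ, hmin⟩ := exists_disutility_minimal hα hΛ hT hc hD hD2 ⟨_, hzero, hJ0⟩
  have hJ : disutility τ P α Λ c D φ ≠ ∞ := ne_top_of_le_ne_top hJ0 (hmin _ hzero)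
  obtain ⟨hQ', hmax⟩ :=
    tilted_mem_finiteEntropy_of_minimal hT hα hΛ hκ hc hD hD2 hexp hφ hJ hmin
  set Q' := P.tilted fun ω => -α * gain τ Λ c D φ ω with hQ'def
  have := hQ'.1
  have hg := hG Q' hQ'
  have hgm := hg.isOptional.measurable hT
  have hae := ae_eq_of_integral_gain_le hT hα hΛ hκ hc hD hD2 hexp hQ' hg hφ hJ hmax
  -- The identity holds almost everywhere under Q' and passes to P because P ≪ Q'.
  have haeP : ∀ᵐ p ∂(τ.prod P), φ p.1 p.2 = G Q' p.1 p.2 :=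
    (Measure.AbsolutelyContinuous.rfl.prod hQ'.2.2.1).ae_le hae
  obtain ⟨-, hJeq⟩ := gain_ae_eq_of_ae_eq (α := α) (Λ := Λ) (c := c) (D := D) hT hφ.1
    hg.isOptional haeP
  have hgs : G Q' ∈ strategies τ P 𝒢 :=
    ⟨hg.isOptional, hQ'.2.2.1.ae_le (ae_memLp_of_memLp_uncurry hgm hg.memLp)⟩
  have hJg : disutility τ P α Λ c D (G Q') ≠ ∞ := hJeq ▸ hJ
  have hIeq : ∫ ω, Real.exp (-α * gain τ Λ c D (G Q') ω) ∂P
      = ∫ ω, Real.exp (-α * gain τ Λ c D φ ω) ∂P := by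
    rw [← ENNReal.ofReal_eq_ofReal_iff (integral_nonneg fun _ => (Real.exp_pos _).le)
      (integral_nonneg fun _ => (Real.exp_pos _).le), ofReal_integral_exp_gain hT hc hD hφ hJ,
      ofReal_integral_exp_gain hT hc hD hgs hJg, hJeq]
  have hi := integrable_exp_gain hT hc hD hφ hJ
  obtain ⟨hVi, hφ2⟩ := integrable_gain_and_memLp hT hα hΛ hκ hc hD hD2 hexp hQ' hφ hJ
  have hval : -(1 / α) * Real.log (∫ ω, Real.exp (-α * gain τ Λ c D φ ω) ∂P)
      = dualValue τ P α Λ c (G Q') Q' := by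
    have hcQ := (integrable_sq_add_of_exp hκ hc hD hexp hQ').1
    have hE := integral_gain hcQ (memLp_uncurry_of_finiteEntropy hκ hc hD hD2 hexp hQ') hφ2
      hg.memLp (hg.integral_eq φ hφ.1 hφ2)
    have hsq : ∫ p, (φ p.1 p.2 - G Q' p.1 p.2) ^ 2 ∂(τ.prod Q') = 0 := by
      refine integral_eq_zero_of_ae ?_
      filter_upwards [hae] with p hp
      simp [hp]
    have hH : ∫ ω, llr Q' P ω ∂Q' = -α * (∫ ω, gain τ Λ c D φ ω ∂Q')
        - Real.log (∫ ω, Real.exp (-α * gain τ Λ c D φ ω) ∂P) := by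
      rw [integral_congr_ae (hQ'.2.1.ae_le (llr_tilted_self hi)),
        integral_sub (hVi.const_mul _) (integrable_const _), integral_const_mul]
      simp
    rw [dualValue, hH, hE, hsq]
    field_simp
    ring
  refine ⟨Q', hQ', hgs, hJg, fun ψ hψ => hJeq ▸ hmin ψ hψ, by rw [hIeq, hval], fun Q hQ => ?_⟩
  -- Weak duality is tested against the one optimal φ for every Q: it gives minimality of Q', and
  -- its equality case identifies Q with the tilted measure Q'.
  have hweak := log_disutility_le_dualValue hT hα hΛ hκ hc hD hD2 hexp hQ (hG Q hQ) hφ hJ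
  rw [hval] at hweak
  exact hweak

end StrongDuality

/-! ### Lebesgue measure on [0, T] -/

section TimeMeasure

variable {T : ℝ}

theorem timeMeasure_univ : timeMeasure T univ = ENNReal.ofReal T := by
  rw [timeMeasure, (MeasurableEmbedding.subtype_coe measurableSet_Icc).comap_apply,
    image_univ, Subtype.range_coe, Real.volume_Icc, sub_zero]

instance : IsFiniteMeasure (timeMeasure T) :=
  ⟨by rw [timeMeasure_univ]; exact ENNReal.ofReal_lt_top⟩

theorem timeMeasure_real_univ (hT : 0 < T) : (timeMeasure T).real univ = T := by
  rw [measureReal_def, timeMeasure_univ, ENNReal.toReal_ofReal hT.le]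

theorem memLp_two_of_abs_le {f : Time T → ℝ} (hf : Measurable f) {C : ℝ} (hC : ∀ t, |f t| ≤ C) :
    MemLp f 2 (timeMeasure T) :=
  (memLp_top_of_bound hf.aestronglyMeasurable C (ae_of_all _ hC)).mono_exponent le_top

end TimeMeasure

/-! ### Translation to the price impact model -/

section Market

variable {Ω : Type*} [mΩ : MeasurableSpace Ω] {T : ℝ} {P Q : Measure Ω}
  {𝒢 : Filtration (Time T) mΩ} {S : Time T → Ω → ℝ} {α Λ Φ₀ : ℝ}

theorem IsCadlagAdapted.memLp_path (hT : 0 < T) {X : Time T → Ω → ℝ} (hX : IsCadlagAdapted 𝒢 X)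
    (ω : Ω) : MemLp (fun t => X t ω) 2 (timeMeasure T) := by
  obtain ⟨C, hC⟩ := (hX.cadlag ω).exists_abs_le
  exact memLp_two_of_abs_le ((hX.measurable_uncurry hT).comp measurable_prodMk_right) hC

theorem admissible_eq_strategies (hT : 0 < T) :
    admissible P 𝒢 = strategies (timeMeasure T) P 𝒢 := by
  ext φ
  refine and_congr_right fun hφ => ?_
  have h : ∀ ω, (∫⁻ t, ENNReal.ofReal (φ t ω ^ 2) ∂(timeMeasure T)) < ∞ ↔
      MemLp (fun t => φ t ω) 2 (timeMeasure T) := by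
    intro ω
    have hm : Measurable fun t => φ t ω := (hφ.measurable hT).comp measurable_prodMk_right
    rw [memLp_two_iff_integrable_sq hm.aestronglyMeasurable, Integrable,
      hasFiniteIntegral_iff_ofReal (ae_of_all _ fun t => sq_nonneg _)]
    exact (and_iff_right (hm.pow_const 2).aestronglyMeasurable).symm
  simp only [h]

/-- The part of the profits and losses that does not depend on the strategy. -/
noncomputable def initialGain (hT : 0 < T) (S : Time T → Ω → ℝ) (Φ₀ : ℝ) (ω : Ω) : ℝ :=
  Φ₀ * (S (terminalTime hT) ω - S (initialTime hT) ω)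

/-- The price increment from `t` to the terminal time. -/
noncomputable def futureIncrement (hT : 0 < T) (S : Time T → Ω → ℝ) (t : Time T) (ω : Ω) : ℝ :=
  S (terminalTime hT) ω - S t ω

theorem certaintyEquivalent_eq (hT : 0 < T) (φ : Time T → Ω → ℝ) :
    certaintyEquivalent P hT S α Λ Φ₀ φ = ((-(1 / α) : ℝ) : EReal) *
      ENNReal.log (disutility (timeMeasure T) P α Λ (initialGain hT S Φ₀)
        (futureIncrement hT S) φ) := rfl

theorem neg_one_div_mul_le_iff (hα : 0 < α) {x y : EReal} :
    ((-(1 / α) : ℝ) : EReal) * x ≤ ((-(1 / α) : ℝ) : EReal) * y ↔ y ≤ x := by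
  have h : ∀ z : EReal, ((-(1 / α) : ℝ) : EReal) * z = -(z / (α : EReal)) := by
    intro z
    rw [EReal.coe_neg, EReal.neg_mul, one_div, EReal.coe_inv, EReal.div_eq_inv_mul]
  rw [h, h, EReal.neg_le_neg_iff]
  exact (EReal.strictMono_div_right_of_pos (EReal.coe_pos.2 hα) (EReal.coe_ne_top α)).le_iff_le

theorem certaintyEquivalent_le_iff (hT : 0 < T) (hα : 0 < α) {φ ψ : Time T → Ω → ℝ} :
    certaintyEquivalent P hT S α Λ Φ₀ φ ≤ certaintyEquivalent P hT S α Λ Φ₀ ψ ↔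
      disutility (timeMeasure T) P α Λ (initialGain hT S Φ₀) (futureIncrement hT S) ψ
        ≤ disutility (timeMeasure T) P α Λ (initialGain hT S Φ₀) (futureIncrement hT S) φ := by
  rw [certaintyEquivalent_eq, certaintyEquivalent_eq, neg_one_div_mul_le_iff hα,
    ENNReal.log_le_log_iff]

theorem measurable_initialGain (hS : IsCadlagAdapted 𝒢 S) (hT : 0 < T) :
    Measurable (initialGain hT S Φ₀) := by
  have h : ∀ t, Measurable (S t) := fun t => (hS.adapted t).mono (𝒢.le t) le_rfl
  exact ((h (terminalTime hT)).sub (h (initialTime hT))).const_mul Φ₀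

theorem measurable_futureIncrement (hS : IsCadlagAdapted 𝒢 S) (hT : 0 < T) :
    Measurable (Function.uncurry (futureIncrement hT S)) := by
  have h : Measurable (S (terminalTime hT)) := (hS.adapted _).mono (𝒢.le _) le_rfl
  exact (h.comp measurable_snd).sub (hS.measurable_uncurry hT)

theorem memLp_futureIncrement (hS : IsCadlagAdapted 𝒢 S) (hT : 0 < T) (ω : Ω) :
    MemLp (fun t => futureIncrement hT S t ω) 2 (timeMeasure T) :=
  (memLp_const _).sub (hS.memLp_path hT ω)

theorem integrable_exp_mul_sq [IsFiniteMeasure P] (hS : IsCadlagAdapted 𝒢 S) {a : ℝ}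
    (hexp : (⨆ t, ∫⁻ ω, ENNReal.ofReal (Real.exp (a * S t ω ^ 2)) ∂P) < ∞) (t : Time T) :
    Integrable (fun ω => Real.exp (a * S t ω ^ 2)) P := by
  have hm : Measurable (S t) := (hS.adapted t).mono (𝒢.le _) le_rfl
  refine ⟨by fun_prop, ?_⟩
  rw [hasFiniteIntegral_iff_ofReal (ae_of_all _ fun ω => (Real.exp_pos _).le)]
  exact (le_iSup (fun t => ∫⁻ ω, ENNReal.ofReal (Real.exp (a * S t ω ^ 2)) ∂P) t).trans_lt hexp

/-- By Jensen's inequality, the time average of `S²` inherits the exponential moment. -/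
theorem integrable_exp_mul_average_sq [IsFiniteMeasure P] (hT : 0 < T) (hS : IsCadlagAdapted 𝒢 S)
    {a : ℝ} (ha : 0 < a)
    (hexp : (⨆ t, ∫⁻ ω, ENNReal.ofReal (Real.exp (a * S t ω ^ 2)) ∂P) < ∞) :
    Integrable (fun ω => Real.exp (a * (1 / T * ∫ t, S t ω ^ 2 ∂(timeMeasure T)))) P := by
  have hSm := hS.measurable_uncurry hT
  have hem : Measurable fun p : Time T × Ω => Real.exp (a * S p.1 p.2 ^ 2) :=
    ((hSm.pow_const 2).const_mul a).exp
  have hint : Integrable (fun p : Time T × Ω => Real.exp (a * S p.1 p.2 ^ 2))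
      ((timeMeasure T).prod P) := by
    refine ⟨hem.aestronglyMeasurable, ?_⟩
    rw [hasFiniteIntegral_iff_ofReal (ae_of_all _ fun p => (Real.exp_pos _).le),
      lintegral_prod _ hem.ennreal_ofReal.aemeasurable]
    calc _ ≤ ∫⁻ _, (⨆ t, ∫⁻ ω, ENNReal.ofReal (Real.exp (a * S t ω ^ 2)) ∂P) ∂(timeMeasure T) :=
          lintegral_mono fun t =>
            le_iSup (fun t => ∫⁻ ω, ENNReal.ofReal (Real.exp (a * S t ω ^ 2)) ∂P) t
      _ < ∞ := by
        rw [lintegral_const]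
        exact ENNReal.mul_lt_top hexp (measure_lt_top _ _)
  refine ((hint.integral_prod_right).const_mul (1 / T)).mono'
    (((measurable_integral_sq hSm).const_mul _).const_mul _).exp.aestronglyMeasurable
    (ae_of_all _ fun ω => ?_)
  rw [Real.norm_of_nonneg (Real.exp_pos _).le]
  obtain ⟨C, hC⟩ := (hS.cadlag ω).exists_abs_le
  have hSω : Measurable fun t => S t ω := hSm.comp measurable_prodMk_right
  have hi1 : Integrable (fun t => a * S t ω ^ 2) (timeMeasure T) :=
    (hS.memLp_path hT ω).integrable_sq.const_mul a
  have hi2 : Integrable (fun t => Real.exp (a * S t ω ^ 2)) (timeMeasure T) := by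
    refine (memLp_two_of_abs_le (by fun_prop) (C := Real.exp (a * C ^ 2)) fun t => ?_).integrable
      (by norm_num)
    rw [abs_of_pos (Real.exp_pos _), Real.exp_le_exp]
    exact mul_le_mul_of_nonneg_left
      (sq_le_sq' (neg_le_of_abs_le (hC t)) (le_of_abs_le (hC t))) ha.le
  have : NeZero (timeMeasure T) := ⟨fun h => by
    have := timeMeasure_univ (T := T)
    rw [h, Measure.coe_zero, Pi.zero_apply, eq_comm, ENNReal.ofReal_eq_zero] at this
    exact absurd hT (not_lt.2 this)⟩
  have hJ := convexOn_exp.map_average_le Real.continuous_exp.continuousOn isClosed_univ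
    (ae_of_all _ fun _ => mem_univ _) hi1 hi2
  simp only [average_eq, timeMeasure_real_univ hT, smul_eq_mul, integral_const_mul] at hJ
  refine le_trans (le_of_eq ?_) (hJ.trans (le_of_eq ?_))
  · congr 1; ring
  · rw [one_div]

theorem exists_integrable_exp_risk [IsProbabilityMeasure P] (hT : 0 < T)
    (hS : IsCadlagAdapted 𝒢 S) {a : ℝ} (ha : 0 < a)
    (hexp : (⨆ t, ∫⁻ ω, ENNReal.ofReal (Real.exp (a * S t ω ^ 2)) ∂P) < ∞) :
    ∃ κ : ℝ, 0 < κ ∧ Integrable (fun ω => Real.exp (κ * (initialGain hT S Φ₀ ω ^ 2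
      + ∫ t, futureIncrement hT S t ω ^ 2 ∂(timeMeasure T)))) P := by
  set L : ℝ := 2 * Φ₀ ^ 2 + 2 * T with hL
  have hLpos : 0 < L := by positivity
  -- The risk is at most L(S_T² + S_0² + the time average of S²); the factor 3 turns this sum into a
  -- mean of three terms.
  refine ⟨a / (3 * L), by positivity, ?_⟩
  have hSt := fun t => integrable_exp_mul_sq (P := P) hS hexp t
  refine (((hSt (terminalTime hT)).add (hSt (initialTime hT))).add
    (integrable_exp_mul_average_sq hT hS ha hexp)).mono' ?_ (ae_of_all _ fun ω => ?_)
  · exact ((((measurable_initialGain hS hT).pow_const 2).add (measurable_integral_sq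
      (measurable_futureIncrement hS hT))).const_mul _).exp.aestronglyMeasurable
  rw [Real.norm_of_nonneg (Real.exp_pos _).le]
  simp only [Pi.add_apply]
  set x := S (terminalTime hT) ω with hx
  set y := S (initialTime hT) ω with hy
  set m := ∫ t, S t ω ^ 2 ∂(timeMeasure T) with hm
  have hm0 : 0 ≤ m := integral_nonneg fun _ => sq_nonneg _
  have h1 : ∫ t, futureIncrement hT S t ω ^ 2 ∂(timeMeasure T) ≤ 2 * T * x ^ 2 + 2 * m := by
    have e : 2 * T * x ^ 2 = ∫ _, 2 * x ^ 2 ∂(timeMeasure T) := by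
      rw [integral_const, timeMeasure_real_univ hT, smul_eq_mul]; ring
    have hSi := (hS.memLp_path hT ω).integrable_sq.const_mul 2
    rw [e, hm, ← integral_const_mul, ← integral_add (integrable_const _) hSi]
    refine integral_mono (memLp_futureIncrement hS hT ω).integrable_sq
      ((integrable_const _).add hSi) fun t => ?_
    simp only [futureIncrement, ← hx]
    nlinarith [sq_nonneg (x + S t ω)]
  have h2 : initialGain hT S Φ₀ ω ^ 2 ≤ 2 * Φ₀ ^ 2 * (x ^ 2 + y ^ 2) := by
    simp only [initialGain, ← hx, ← hy, mul_pow]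
    nlinarith [sq_nonneg (x + y), sq_nonneg Φ₀, mul_nonneg (sq_nonneg Φ₀) (sq_nonneg (x + y))]
  have h3 : initialGain hT S Φ₀ ω ^ 2 + ∫ t, futureIncrement hT S t ω ^ 2 ∂(timeMeasure T)
      ≤ L * (x ^ 2 + y ^ 2 + 1 / T * m) := by
    have e : L * (x ^ 2 + y ^ 2 + 1 / T * m) = 2 * Φ₀ ^ 2 * (x ^ 2 + y ^ 2) + 2 * T * x ^ 2 + 2 * m
        + (2 * T * y ^ 2 + 2 * Φ₀ ^ 2 * (1 / T * m)) := by
      rw [hL]; field_simp; ring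
    have : 0 ≤ 2 * T * y ^ 2 + 2 * Φ₀ ^ 2 * (1 / T * m) := by positivity
    linarith
  have h4 : a / (3 * L) * (initialGain hT S Φ₀ ω ^ 2
      + ∫ t, futureIncrement hT S t ω ^ 2 ∂(timeMeasure T))
      ≤ (a * x ^ 2 + a * y ^ 2 + a * (1 / T * m)) / 3 := by
    calc _ ≤ a / (3 * L) * (L * (x ^ 2 + y ^ 2 + 1 / T * m)) := by gcongr
      _ = _ := by field_simp
  refine (Real.exp_le_exp.2 h4).trans ?_
  have p1 := Real.exp_pos (a * x ^ 2)
  have p2 := Real.exp_pos (a * y ^ 2)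
  have p3 := Real.exp_pos (a * (1 / T * m))
  -- A mean of three numbers is at most one of them, so its exponential is at most the sum of the
  -- three exponentials.
  by_cases q1 : (a * x ^ 2 + a * y ^ 2 + a * (1 / T * m)) / 3 ≤ a * x ^ 2
  · linarith [Real.exp_le_exp.2 q1]
  by_cases q2 : (a * x ^ 2 + a * y ^ 2 + a * (1 / T * m)) / 3 ≤ a * y ^ 2
  · linarith [Real.exp_le_exp.2 q2]
  have q3 : (a * x ^ 2 + a * y ^ 2 + a * (1 / T * m)) / 3 ≤ a * (1 / T * m) := by
    by_contra q3
    linarith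
  linarith [Real.exp_le_exp.2 q3]

theorem memLp_two_of_finiteEntropy [IsProbabilityMeasure P] (hS : IsCadlagAdapted 𝒢 S) {a : ℝ}
    (ha : 0 < a) (hexp : (⨆ t, ∫⁻ ω, ENNReal.ofReal (Real.exp (a * S t ω ^ 2)) ∂P) < ∞)
    (hQ : Q ∈ finiteEntropy P) (t : Time T) : MemLp (S t) 2 Q := by
  have hm : Measurable (S t) := (hS.adapted t).mono (𝒢.le _) le_rfl
  rw [memLp_two_iff_integrable_sq hm.aestronglyMeasurable]
  have h := integrable_of_integrable_exp hQ (X := fun ω => a * S t ω ^ 2) (by fun_prop)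
    (fun ω => by positivity) (integrable_exp_mul_sq hS hexp t)
  exact (h.const_mul a⁻¹).congr (ae_of_all _ fun ω => by field_simp)

theorem integral_condExp_sq_le [IsFiniteMeasure Q] (t : Time T) {X : Ω → ℝ}
    (hX : MemLp X 2 Q) : ∫ ω, (Q[X | 𝒢 t]) ω ^ 2 ∂Q ≤ ∫ ω, X ω ^ 2 ∂Q := by
  have hc : MemLp (Q[X | 𝒢 t]) 2 Q := hX.condExp (by norm_num)
  rw [integral_sq_eq_norm_sq hc, integral_sq_eq_norm_sq hX, Lp.norm_toLp, Lp.norm_toLp]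
  gcongr
  · exact hX.eLpNorm_ne_top
  · exact eLpNorm_condExp_le_eLpNorm X (by norm_num)

theorem IsMartingaleVersion.memLp_uncurry [IsProbabilityMeasure Q] (hT : 0 < T) {X : Ω → ℝ}
    (hX : MemLp X 2 Q) {M : Time T → Ω → ℝ} (hM : IsMartingaleVersion Q 𝒢 X M) :
    MemLp (Function.uncurry M) 2 ((timeMeasure T).prod Q) := by
  have hMm := hM.cadlagAdapted.measurable_uncurry hT
  have hMt : ∀ t, MemLp (M t) 2 Q := fun t =>
    (memLp_congr_ae (hM.version t)).2 (hX.condExp (by norm_num))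
  rw [memLp_two_iff_integrable_sq hMm.aestronglyMeasurable,
    integrable_prod_iff (hMm.pow_const 2).aestronglyMeasurable]
  refine ⟨ae_of_all _ fun t => (hMt t).integrable_sq, ?_⟩
  refine (integrable_const (∫ ω, X ω ^ 2 ∂Q)).mono'
    ((hMm.pow_const 2).norm.stronglyMeasurable.integral_prod_right).aestronglyMeasurable
    (ae_of_all _ fun t => ?_)
  rw [Real.norm_of_nonneg (integral_nonneg fun _ => norm_nonneg _)]
  refine le_trans (le_of_eq ?_) (integral_condExp_sq_le (𝒢 := 𝒢) t hX)
  refine integral_congr_ae ?_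
  filter_upwards [hM.version t] with ω h
  simp [Function.uncurry, h]

/-- On optional processes, a random variable may be replaced by its martingale. -/
theorem IsMartingaleVersion.integral_mul_eq [IsProbabilityMeasure Q] (hT : 0 < T) {X : Ω → ℝ}
    (hX : MemLp X 2 Q) {M : Time T → Ω → ℝ} (hM : IsMartingaleVersion Q 𝒢 X M)
    {φ : Time T → Ω → ℝ} (hφ : IsOptional 𝒢 φ)
    (hφ2 : MemLp (Function.uncurry φ) 2 ((timeMeasure T).prod Q)) :
    ∫ p, X p.2 * φ p.1 p.2 ∂((timeMeasure T).prod Q)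
      = ∫ p, M p.1 p.2 * φ p.1 p.2 ∂((timeMeasure T).prod Q) := by
  have hXφ : Integrable (fun p : Time T × Ω => X p.2 * φ p.1 p.2) ((timeMeasure T).prod Q) :=
    (hX.comp_snd (timeMeasure T)).integrable_mul hφ2
  have hMφ : Integrable (fun p : Time T × Ω => M p.1 p.2 * φ p.1 p.2) ((timeMeasure T).prod Q) :=
    (hM.memLp_uncurry hT hX).integrable_mul hφ2
  rw [integral_prod _ hXφ, integral_prod _ hMφ]
  refine integral_congr_ae ?_
  filter_upwards [hXφ.prod_right_ae] with t h
  have hpull := condExp_mul_of_stronglyMeasurable_right (m := 𝒢 t) (μ := Q) (f := X) (g := φ t)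
    (hφ.adapted t).stronglyMeasurable h (hX.integrable (by norm_num))
  calc ∫ ω, X ω * φ t ω ∂Q = ∫ ω, (Q[X * φ t | 𝒢 t]) ω ∂Q := (integral_condExp (𝒢.le t)).symm
    _ = ∫ ω, M t ω * φ t ω ∂Q := by
      refine integral_congr_ae ?_
      filter_upwards [hpull, hM.version t] with ω h1 h2
      rw [h1, h2, Pi.mul_apply]

/-- In D = S_T - S the process S is already optional, so only S_T has to be replaced by its
martingale. -/
theorem isOptionalProjection_inducedStrategy [IsProbabilityMeasure Q] (hT : 0 < T) (hΛ : 0 < Λ)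
    (hS : IsCadlagAdapted 𝒢 S) (hST : MemLp (S (terminalTime hT)) 2 Q)
    (hD : MemLp (Function.uncurry (futureIncrement hT S)) 2 ((timeMeasure T).prod Q))
    (hM : IsMartingaleVersion Q 𝒢 (S (terminalTime hT))
      (condExpVersion Q 𝒢 (S (terminalTime hT)))) :
    IsOptionalProjection (timeMeasure T) Q 𝒢 Λ (futureIncrement hT S)
      (inducedStrategy 𝒢 hT S Λ Q) := by
  set M := condExpVersion Q 𝒢 (S (terminalTime hT)) with hMdef
  have hST' : MemLp (fun p : Time T × Ω => S (terminalTime hT) p.2) 2 ((timeMeasure T).prod Q) :=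
    hST.comp_snd (timeMeasure T)
  have hM2 := hM.memLp_uncurry hT hST
  have hS2 : MemLp (fun p : Time T × Ω => S p.1 p.2) 2 ((timeMeasure T).prod Q) := by
    refine (hST'.sub hD).ae_eq (ae_of_all _ fun p => ?_)
    simp [futureIncrement, Function.uncurry]
  refine ⟨?_, ?_, fun φ hφ hφ2 => ?_⟩
  · exact Measurable.div_const (Measurable.sub hM.cadlagAdapted.isOptional hS.isOptional) Λ
  · refine ((hM2.sub hS2).const_mul Λ⁻¹).ae_eq (ae_of_all _ fun p => ?_)
    simp only [inducedStrategy, Function.uncurry, Pi.sub_apply, ← hMdef]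
    rw [div_eq_inv_mul]
  · have h := hM.integral_mul_eq hT hST hφ hφ2
    have i1 : Integrable (fun p : Time T × Ω => S (terminalTime hT) p.2 * φ p.1 p.2)
      ((timeMeasure T).prod Q) := hST'.integrable_mul hφ2
    have i2 : Integrable (fun p : Time T × Ω => S p.1 p.2 * φ p.1 p.2)
      ((timeMeasure T).prod Q) := hS2.integrable_mul hφ2
    have i3 : Integrable (fun p : Time T × Ω => M p.1 p.2 * φ p.1 p.2)
      ((timeMeasure T).prod Q) := hM2.integrable_mul hφ2
    simp only [futureIncrement, sub_mul]
    rw [integral_sub i1 i2, h, ← integral_sub i3 i2, ← integral_const_mul]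
    refine integral_congr_ae (ae_of_all _ fun p => ?_)
    simp only [inducedStrategy, ← hMdef]
    field_simp

theorem integrable_dualIntegrand_and_dualFunctional_eq (hT : 0 < T) (hΛ : 0 < Λ)
    (hQ : Q ∈ finiteEntropy P) (hc : Integrable (initialGain hT S Φ₀) Q)
    (hg : MemLp (Function.uncurry (inducedStrategy 𝒢 hT S Λ Q)) 2 ((timeMeasure T).prod Q)) :
    Integrable (dualIntegrand P 𝒢 hT S α Λ Φ₀ Q) Q ∧
      dualFunctional P 𝒢 hT S α Λ Φ₀ Q = dualValue (timeMeasure T) P α Λ (initialGain hT S Φ₀)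
        (inducedStrategy 𝒢 hT S Λ Q) Q := by
  have := hQ.1
  have hgg : Integrable (fun p : Time T × Ω => inducedStrategy 𝒢 hT S Λ Q p.1 p.2 ^ 2)
    ((timeMeasure T).prod Q) := hg.integrable_sq
  have e : dualIntegrand P 𝒢 hT S α Λ Φ₀ Q = fun ω => initialGain hT S Φ₀ ω + 1 / α * llr Q P ω
      + Λ / 2 * ∫ t, inducedStrategy 𝒢 hT S Λ Q t ω ^ 2 ∂(timeMeasure T) := by
    ext ω
    simp only [dualIntegrand, initialGain, inducedStrategy, sq_abs, div_pow]
    rw [integral_div]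
    field_simp
  have i1 : Integrable (fun ω => initialGain hT S Φ₀ ω + 1 / α * llr Q P ω) Q :=
    hc.add (hQ.2.2.2.const_mul (1 / α))
  have i2 : Integrable (fun ω =>
      Λ / 2 * ∫ t, inducedStrategy 𝒢 hT S Λ Q t ω ^ 2 ∂(timeMeasure T)) Q :=
    hgg.integral_prod_right.const_mul _
  rw [dualFunctional, e]
  refine ⟨i1.add i2, ?_⟩
  rw [integral_add i1 i2, integral_add hc (hQ.2.2.2.const_mul _), integral_const_mul,
    integral_const_mul, dualValue, integral_prod_symm _ hgg]

end Market

end PriceImpact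

/-! ### The main theorem -/

open PriceImpact

theorem propositionA1 {Ω : Type*} [mΩ : MeasurableSpace Ω]
    (P : Measure Ω) [IsProbabilityMeasure P]
    (T : ℝ) (hT : 0 < T)
    (𝒢 : Filtration (PriceImpact.Time T) mΩ) (h𝒢 : PriceImpact.UsualConditions P 𝒢)
    (S : PriceImpact.Time T → Ω → ℝ) (hS : PriceImpact.IsCadlagAdapted 𝒢 S)
    (α Λ Φ₀ : ℝ) (hα : 0 < α) (hΛ : 0 < Λ)
    (hexp : ∃ a : ℝ, 0 < a ∧
      (⨆ t, ∫⁻ ω, ENNReal.ofReal (Real.exp (a * S t ω ^ 2)) ∂P) < ∞) :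
    -- the expressions in the dual problem are well defined: `S_T` is `Q`-integrable, the
    -- `Q`-martingale `E_Q[S_T | 𝒢_t]` has a càdlàg version, and the dual integrand is `Q`-integrable
    (∀ Q ∈ PriceImpact.finiteEntropy P,
      Integrable (S (PriceImpact.terminalTime hT)) Q ∧
      PriceImpact.IsMartingaleVersion Q 𝒢 (S (PriceImpact.terminalTime hT))
        (PriceImpact.condExpVersion Q 𝒢 (S (PriceImpact.terminalTime hT))) ∧
      Integrable (PriceImpact.dualIntegrand P 𝒢 hT S α Λ Φ₀ Q) Q) ∧
    -- the primal maximum is attained and equals the dual infimum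
    IsGreatest
      (PriceImpact.certaintyEquivalent P hT S α Λ Φ₀ '' PriceImpact.admissible P 𝒢)
      (⨅ Q ∈ PriceImpact.finiteEntropy P,
        (PriceImpact.dualFunctional P 𝒢 hT S α Λ Φ₀ Q : EReal)) ∧
    -- there is a dual minimizer `Q'`; it is unique, and it induces an optimal strategy,
    -- which is unique up to `dt ⊗ P`-null sets
    ∃ Q' ∈ PriceImpact.finiteEntropy P,
      IsMinOn (PriceImpact.dualFunctional P 𝒢 hT S α Λ Φ₀) (PriceImpact.finiteEntropy P) Q' ∧
      (∀ Q ∈ PriceImpact.finiteEntropy P,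
        IsMinOn (PriceImpact.dualFunctional P 𝒢 hT S α Λ Φ₀) (PriceImpact.finiteEntropy P) Q →
          Q = Q') ∧
      PriceImpact.inducedStrategy 𝒢 hT S Λ Q' ∈ PriceImpact.admissible P 𝒢 ∧
      IsMaxOn (PriceImpact.certaintyEquivalent P hT S α Λ Φ₀) (PriceImpact.admissible P 𝒢)
        (PriceImpact.inducedStrategy 𝒢 hT S Λ Q') ∧
      ∀ φ ∈ PriceImpact.admissible P 𝒢,
        IsMaxOn (PriceImpact.certaintyEquivalent P hT S α Λ Φ₀) (PriceImpact.admissible P 𝒢) φ →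
          ∀ᵐ p ∂((PriceImpact.timeMeasure T).prod P),
            φ p.1 p.2 = PriceImpact.inducedStrategy 𝒢 hT S Λ Q' p.1 p.2 := by
  obtain ⟨a, ha, hexp⟩ := hexp
  obtain ⟨κ, hκ, hrisk⟩ := exists_integrable_exp_risk (Φ₀ := Φ₀) hT hS ha hexp
  have hc : Measurable (initialGain hT S Φ₀) := measurable_initialGain hS hT
  have hD := measurable_futureIncrement hS hT
  have hD2 := memLp_futureIncrement hS hT
  have hM : ∀ Q ∈ finiteEntropy P, IsMartingaleVersion Q 𝒢 (S (terminalTime hT))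
      (condExpVersion Q 𝒢 (S (terminalTime hT))) := by
    intro Q hQ
    have := hQ.1
    exact isMartingaleVersion_condExpVersion (exists_isMartingaleVersion hT h𝒢 hQ.2.2.1
      ((memLp_two_of_finiteEntropy hS ha hexp hQ _).integrable (by norm_num)))
  have hG : ∀ Q ∈ finiteEntropy P, IsOptionalProjection (timeMeasure T) Q 𝒢 Λ
      (futureIncrement hT S) (inducedStrategy 𝒢 hT S Λ Q) := by
    intro Q hQ
    have := hQ.1
    exact isOptionalProjection_inducedStrategy hT hΛ hS (memLp_two_of_finiteEntropy hS ha hexp hQ _)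
      (memLp_uncurry_of_finiteEntropy hκ hc hD hD2 hrisk hQ) (hM Q hQ)
  have hdual := fun Q (hQ : Q ∈ finiteEntropy P) =>
    integrable_dualIntegrand_and_dualFunctional_eq (α := α) hT hΛ hQ
      (integrable_sq_add_of_exp hκ hc hD hrisk hQ).1 (hG Q hQ).memLp
  obtain ⟨Q', hQ', hφ, hJ, hmin, hval, hQmin⟩ :=
    exists_dual_minimizer hT hα hΛ hκ hc hD hD2 hrisk hG
  rw [← admissible_eq_strategies hT] at hφ hmin
  have hminOn : IsMinOn (dualFunctional P 𝒢 hT S α Λ Φ₀) (finiteEntropy P) Q' := fun Q hQ => by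
    rw [mem_ofPred_eq, (hdual Q hQ).2, (hdual Q' hQ').2]
    exact (hQmin Q hQ).1
  have hmaxOn : IsMaxOn (certaintyEquivalent P hT S α Λ Φ₀) (admissible P 𝒢)
      (inducedStrategy 𝒢 hT S Λ Q') := fun ψ hψ => (certaintyEquivalent_le_iff hT hα).2 (hmin ψ hψ)
  have hCE : certaintyEquivalent P hT S α Λ Φ₀ (inducedStrategy 𝒢 hT S Λ Q')
      = (dualFunctional P 𝒢 hT S α Λ Φ₀ Q' : EReal) := by
    -- The expectation is finite and positive at the optimum, so the extended logarithm is the real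
    -- one and the value is a real number.
    rw [certaintyEquivalent_eq, (hdual Q' hQ').2, ← hval, EReal.coe_mul]
    have hφ' := hφ
    rw [admissible_eq_strategies hT] at hφ'
    rw [← ofReal_integral_exp_gain hT hc hD hφ' hJ, ENNReal.log_ofReal_of_pos
      (integral_exp_pos (integrable_exp_gain hT hc hD hφ' hJ))]
  have hInf : (⨅ Q ∈ finiteEntropy P, (dualFunctional P 𝒢 hT S α Λ Φ₀ Q : EReal))
      = (dualFunctional P 𝒢 hT S α Λ Φ₀ Q' : EReal) :=
    le_antisymm (iInf₂_le Q' hQ') (le_iInf₂ fun Q hQ => EReal.coe_le_coe_iff.2 (hminOn hQ))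
  refine ⟨fun Q hQ => ⟨?_, hM Q hQ, (hdual Q hQ).1⟩, ?_, Q', hQ', hminOn, fun Q hQ hQm => ?_, hφ,
    hmaxOn, fun φ hφ' hφm => ?_⟩
  · have := hQ.1
    exact (memLp_two_of_finiteEntropy hS ha hexp hQ _).integrable (by norm_num)
  · rw [hInf, ← hCE]
    exact ⟨mem_image_of_mem _ hφ, forall_mem_image.2 fun ψ hψ => hmaxOn hψ⟩
  · refine (hQmin Q hQ).2 ?_
    rw [← (hdual Q hQ).2, ← (hdual Q' hQ').2]
    exact hQm hQ'
  · have hle := (certaintyEquivalent_le_iff hT hα).1 (hφm hφ)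
    rw [admissible_eq_strategies hT] at hφ hφ' hmin
    exact ae_eq_of_disutility_minimal hα hΛ hT hc hD hD2 hφ' hφ hJ hmin hle le_rfl
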